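/- Let $A\in\mathbb R^{m\times n}$ be nonzero with rank $n_r$ and singular values $\sigma_1(A)\ge\dots\ge\sigma_{n_r}(A)>0=\sigma_{n_r+1}(A)=\cdots$, let $b\in\mathbb R^m$, $\lambda>0$ and $1\le k\le m$. For $S\subseteq\{1,\dots,m\}$ let $A_S$, $b_S$ be the rows of $A$ and the entries of $b$ with index in $S$. Let $x^*=A^+b$ ($A^+$ the Moore–Penrose pseudoinverse) be the minimal-norm ordinary least-squares solution and $r=b-Ax^*$. Let $\rho=k\text{-DPP}(AA^\top+\lambda kI)$ be the distribution on size-$k$ subsets with $$\Pr[S]=\frac{\det(A_SA_S^\top+\lambda kI)}{\sum_{|S'|=k}\det(A_{S'}A_{S'}^\top+\lambda kI)} .$$ Let $S_0,S_1,\dots$ be independent with law $\rho$, let $x_0\in\operatorname{range}(A^\top)$ be deterministic, and define the ReBlocK iterates and their tail averages by $$x_{t+1}=x_t+A_{S_t}^\top(A_{S_t}A_{S_t}^\top+\lambda kI)^{-1}(b_{S_t}-A_{S_t}x_t),\qquad \overline x_T=\frac1{T-T_b}\sum_{t=T_b+1}^{T}x_t .$$ Put $\overline P=\mathbb E_{S\sim\rho}[A_S^\top(A_SA_S^\top+\lambda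 kI)^{-1}A_S]$, let $\alpha=\sigma^+_{\min}(\overline P)$ be its minimum nonzero singular value, and let $V=\mathbb E_{S\sim\rho}\|A_S^\top(A_SA_S^\top+\lambda kI)^{-1}r_S\|^2$. Then $0<\alpha\le1$, all expectations below exist, and: 1. for every integer $T\ge0$, $\ \|\mathbb E[x_T]-x^*\|\le(1-\alpha)^T\|x_0-x^*\|$; 2. for all integers $0\le T_b<T$, $\ \mathbb E\|\overline x_T-x^*\|^2\le 2(1-\alpha)^{T_b+1}\|x_0-x^*\|^2+\dfrac{4}{\alpha^2(T-T_b)}V$; 3. $V\le\dfrac1{4\lambda}\max_i r_i^2$; 4. for every integer $0\le\ell<k$, $$\alpha\ \ge\ \frac{k-\ell}{(k-\ell)+\kappa_\ell^2(A)+(m+k-2\ell)\frac{\lambda k}{\sigma_{n_r}^2(A)}},\qquad \kappa_\ell^2(A)=\sum_{j=\ell+1}^{n_r}\frac{\sigma_j^2(A)}{\sigma_{n_r}^2(A)} ,$$ where the sum is $0$ if $\ell\ge n_r$. -/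

import Mathlib

open MeasureTheory ProbabilityTheory

noncomputable section

namespace ReBlocK

/-- The four Penrose conditions: `X` is a Moore-Penrose pseudoinverse of the real matrix `A`. -/
structure IsMoorePenrose {m n : ℕ} (A : Matrix (Fin m) (Fin n) ℝ)
    (X : Matrix (Fin n) (Fin m) ℝ) : Prop where
  mul_mul_self : A * X * A = A
  self_mul_mul : X * A * X = X
  symm_left : (A * X).transpose = A * X
  symm_right : (X * A).transpose = X * A

theorem exists_isMoorePenrose {m n : ℕ} (A : Matrix (Fin m) (Fin n) ℝ) :
    ∃ X, IsMoorePenrose A X := by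
  have hH : IsSelfAdjoint (A.transpose * A) := by
    have h := Matrix.isHermitian_conjTranspose_mul_self A
    rw [Matrix.conjTranspose_eq_transpose_of_trivial] at h
    exact h
  obtain ⟨G, hGs, hHG, hHGH, hGHG⟩ : ∃ G : Matrix (Fin n) (Fin n) ℝ, G.transpose = G ∧
      (A.transpose * A) * G = G * (A.transpose * A) ∧
      (A.transpose * A) * G * (A.transpose * A) = A.transpose * A ∧
      G * (A.transpose * A) * G = G := by
    generalize A.transpose * A = H at hH
    have hfin : (spectrum ℝ H).Finite := Matrix.finite_real_spectrum
    have hc : ∀ f : ℝ → ℝ, ContinuousOn f (spectrum ℝ H) := fun f => hfin.continuousOn f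
    have hid : cfc (fun x : ℝ => x) H = H := cfc_id' ℝ H
    have h1 : cfc (fun x : ℝ => x⁻¹) H * H = cfc (fun x : ℝ => x⁻¹ * x) H := by
      conv_lhs => rw [← hid, hid]
      nth_rewrite 2 [← hid]
      rw [← cfc_mul _ _ H (hc _) (hc _)]
    have h2 : H * cfc (fun x : ℝ => x⁻¹) H = cfc (fun x : ℝ => x⁻¹ * x) H := by
      nth_rewrite 1 [← hid]
      rw [← cfc_mul _ _ H (hc _) (hc _)]
      simp_rw [mul_comm]
    refine ⟨cfc (fun x : ℝ => x⁻¹) H, ?_, ?_, ?_, ?_⟩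
    · have h := cfc_predicate (fun x : ℝ => x⁻¹) H
      have h' := h.star_eq
      rwa [Matrix.star_eq_conjTranspose, Matrix.conjTranspose_eq_transpose_of_trivial] at h'
    · rw [h1, h2]
    · rw [h2]
      nth_rewrite 2 [← hid]
      rw [← cfc_mul _ _ H (hc _) (hc _)]
      conv_rhs => rw [← hid]
      congr 1
      funext x
      by_cases hx : x = 0 <;> simp [hx]
    · rw [h1, ← cfc_mul _ _ H (hc _) (hc _)]
      congr 1
      funext x
      by_cases hx : x = 0 <;> simp [hx]
  have key : A * G * (A.transpose * A) = A := by
    have hE : (A * G * (A.transpose * A) - A).transpose * (A * G * (A.transpose * A) - A) = 0 := by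
      have e1 : (A * G * (A.transpose * A) - A).transpose =
          (A.transpose * A * G - 1) * A.transpose := by
        simp only [Matrix.transpose_sub, Matrix.transpose_mul, Matrix.transpose_transpose, hGs,
          Matrix.sub_mul, Matrix.one_mul, Matrix.mul_assoc]
      have e2 : A.transpose * (A * G * (A.transpose * A) - A) = 0 := by
        rw [Matrix.mul_sub, sub_eq_zero]
        simpa only [Matrix.mul_assoc] using hHGH
      rw [e1, Matrix.mul_assoc, e2, Matrix.mul_zero]
    rw [← Matrix.conjTranspose_eq_transpose_of_trivial,
      Matrix.conjTranspose_mul_self_eq_zero, sub_eq_zero] at hE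
    exact hE
  refine ⟨G * A.transpose, ?_, ?_, ?_, ?_⟩
  · rw [Matrix.mul_assoc] at key
    simpa only [Matrix.mul_assoc] using key
  · have h := congrArg (· * A.transpose) hGHG
    simpa only [Matrix.mul_assoc] using h
  · simp only [Matrix.transpose_mul, Matrix.transpose_transpose, hGs, Matrix.mul_assoc]
  · simp only [Matrix.transpose_mul, Matrix.transpose_transpose, hGs, Matrix.mul_assoc]
    simpa only [Matrix.mul_assoc] using hHG

/-- The Moore-Penrose pseudoinverse `A⁺`. -/
def pinv {m n : ℕ} (A : Matrix (Fin m) (Fin n) ℝ) : Matrix (Fin n) (Fin m) ℝ :=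
  (exists_isMoorePenrose A).choose

theorem pinv_isMoorePenrose {m n : ℕ} (A : Matrix (Fin m) (Fin n) ℝ) :
    IsMoorePenrose A (pinv A) :=
  (exists_isMoorePenrose A).choose_spec

/-- The minimal-norm ordinary least-squares solution `x* = A⁺ b`. -/
def lsSol {m n : ℕ} (A : Matrix (Fin m) (Fin n) ℝ) (b : EuclideanSpace ℝ (Fin m)) :
    EuclideanSpace ℝ (Fin n) :=
  Matrix.toEuclideanLin (pinv A) b

/-- The residual `r = b - A x*`. -/
def residual {m n : ℕ} (A : Matrix (Fin m) (Fin n) ℝ) (b : EuclideanSpace ℝ (Fin m)) :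
    EuclideanSpace ℝ (Fin m) :=
  b - Matrix.toEuclideanLin A (lsSol A b)

/-- `A_S`: the rows of `A` with index in `S` (indexed by the elements of `S`). -/
def rowBlock {m n : ℕ} (A : Matrix (Fin m) (Fin n) ℝ) (S : Finset (Fin m)) :
    Matrix S (Fin n) ℝ :=
  A.submatrix (fun i : S => (i : Fin m)) id

/-- `b_S`: the entries of `b` with index in `S`. -/
def vecBlock {m : ℕ} (b : EuclideanSpace ℝ (Fin m)) (S : Finset (Fin m)) :
    EuclideanSpace ℝ S :=
  WithLp.toLp 2 (fun i : S => b (i : Fin m))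

/-- `A_S A_Sᵀ + λ k I`. -/
def regGram {m n : ℕ} (A : Matrix (Fin m) (Fin n) ℝ) (lam : ℝ) (k : ℕ) (S : Finset (Fin m)) :
    Matrix S S ℝ :=
  rowBlock A S * (rowBlock A S).transpose + (lam * (k : ℝ)) • (1 : Matrix S S ℝ)

/-- The matrix `A_Sᵀ M(A_S)` with the ReBlocK mass matrix `M(A_S) = (A_S A_Sᵀ + λ k I)⁻¹`. -/
def gain {m n : ℕ} (A : Matrix (Fin m) (Fin n) ℝ) (lam : ℝ) (k : ℕ) (S : Finset (Fin m)) :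
    Matrix (Fin n) S ℝ :=
  (rowBlock A S).transpose * (regGram A lam k S)⁻¹

/-- One ReBlocK update: `x + A_Sᵀ (A_S A_Sᵀ + λ k I)⁻¹ (b_S - A_S x)`. -/
def step {m n : ℕ} (A : Matrix (Fin m) (Fin n) ℝ) (b : EuclideanSpace ℝ (Fin m)) (lam : ℝ)
    (k : ℕ) (S : Finset (Fin m)) (x : EuclideanSpace ℝ (Fin n)) : EuclideanSpace ℝ (Fin n) :=
  x + Matrix.toEuclideanLin (gain A lam k S)
    (vecBlock b S - Matrix.toEuclideanLin (rowBlock A S) x)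

/-- The ReBlocK iterates `x_t` started from `x₀`, using the blocks `S 0, S 1, …`. -/
def iter {m n : ℕ} (A : Matrix (Fin m) (Fin n) ℝ) (b : EuclideanSpace ℝ (Fin m)) (lam : ℝ)
    (k : ℕ) (x₀ : EuclideanSpace ℝ (Fin n)) (S : ℕ → Finset (Fin m)) :
    ℕ → EuclideanSpace ℝ (Fin n)
  | 0 => x₀
  | t + 1 => step A b lam k (S t) (iter A b lam k x₀ S t)

/-- The tail average `(T - T_b)⁻¹ ∑_{t = T_b + 1}^{T} x_t`. -/
def tailAvg {n : ℕ} (x : ℕ → EuclideanSpace ℝ (Fin n)) (Tb T : ℕ) : EuclideanSpace ℝ (Fin n) :=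
  ((T : ℝ) - (Tb : ℝ))⁻¹ • ∑ t ∈ Finset.Icc (Tb + 1) T, x t

/-- The probability mass function of `k`-DPP`(A Aᵀ + λ k I)`: a subset `S` of size `k` has
probability `det (A_S A_Sᵀ + λ k I) / ∑_{|S'| = k} det (A_{S'} A_{S'}ᵀ + λ k I)`, and all other
subsets have probability zero. -/
def dppProb {m n : ℕ} (A : Matrix (Fin m) (Fin n) ℝ) (lam : ℝ) (k : ℕ) (S : Finset (Fin m)) : ℝ :=
  if S.card = k then
    (regGram A lam k S).det /
      ∑ S' ∈ Finset.powersetCard k (Finset.univ : Finset (Fin m)), (regGram A lam k S').det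
  else 0

/-- `P̄ = E_S [A_Sᵀ (A_S A_Sᵀ + λ k I)⁻¹ A_S]` for `S ∼ k`-DPP`(A Aᵀ + λ k I)`. -/
def meanProj {m n : ℕ} (A : Matrix (Fin m) (Fin n) ℝ) (lam : ℝ) (k : ℕ) :
    Matrix (Fin n) (Fin n) ℝ :=
  ∑ S : Finset (Fin m), dppProb A lam k S • (gain A lam k S * rowBlock A S)

/-- `V = E_S ‖A_Sᵀ (A_S A_Sᵀ + λ k I)⁻¹ r_S‖²` for `S ∼ k`-DPP`(A Aᵀ + λ k I)`. -/
def varTerm {m n : ℕ} (A : Matrix (Fin m) (Fin n) ℝ) (b : EuclideanSpace ℝ (Fin m)) (lam : ℝ)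
    (k : ℕ) : ℝ :=
  ∑ S : Finset (Fin m), dppProb A lam k S *
    ‖Matrix.toEuclideanLin (gain A lam k S) (vecBlock (residual A b) S)‖ ^ 2

/-- The `j`-th largest singular value `σ_j(X)`, for `j ≥ 1` (Mathlib counts from zero). -/
def sigma {m n : ℕ} (X : Matrix (Fin m) (Fin n) ℝ) (j : ℕ) : ℝ :=
  (Matrix.toEuclideanLin X).singularValues (j - 1)

/-- The minimum nonzero singular value `σ_min⁺(X)` (meaningful for `X ≠ 0`). -/
def sigmaMinPos {m n : ℕ} (X : Matrix (Fin m) (Fin n) ℝ) : ℝ :=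
  sInf {s : ℝ | s ≠ 0 ∧ ∃ j : ℕ, 1 ≤ j ∧ s = sigma X j}

/-- The convergence parameter `α = σ_min⁺(P̄)`. -/
def alpha {m n : ℕ} (A : Matrix (Fin m) (Fin n) ℝ) (lam : ℝ) (k : ℕ) : ℝ :=
  sigmaMinPos (meanProj A lam k)

/-- `κ_ℓ²(A) = ∑_{j > ℓ}^{n_r} σ_j(A)² / σ_{n_r}(A)²`, where `n_r` is the rank of `A`. -/
def kappaSq {m n : ℕ} (A : Matrix (Fin m) (Fin n) ℝ) (l : ℕ) : ℝ :=
  ∑ j ∈ Finset.Ioc l A.rank, sigma A j ^ 2 / sigma A A.rank ^ 2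

end ReBlocK

end

/-! The error `x_t - x*` obeys a random affine recursion `e ↦ (I - P_S) e + g_S`, with `P_S = A_Sᵀ
(A_S A_Sᵀ + λkI)⁻¹ A_S` symmetric, `P_S² ≤ P_S`, and noise `g_S = A_Sᵀ (A_S A_Sᵀ + λkI)⁻¹ r_S`.
Everything rests on the mean of the inverted blocks `(A_S A_Sᵀ + λkI)⁻¹`, extended by zero to `m ×
m` matrices. Under the determinantal law this mean is diagonal in the left singular basis of `A`.

The reason is that the sum of the `k × k` principal minors is a characteristic polynomial
coefficient, hence invariant under orthogonal conjugation. Applying this to a rank-one update `M + v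
vᵀ` and expanding each minor by the matrix determinant lemma gives the same invariance for `∑ det
M_S · v_Sᵀ M_S⁻¹ v_S`. Polarization then diagonalizes the bilinear form (`minorForm_conj`). Two
consequences follow. First, `Aᵀ r = 0` forces `E g_S = 0` (`sum_dppProb_gain`), so the mean error is
just multiplied by `I - P̄`. Second, the nonzero eigenvalues of `P̄` are explicit ratios of
elementary symmetric sums, which an exchange argument bounds below (`minorSum_diagonal_le`,
`meanProj_lower`).

For the tail average, the error is split into a bias part without noise and a noise part started at
`0`. Since `P_S² ≤ P_S`, the mean square of the bias contracts by `1 - α` per step. The noise has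
mean zero, second moment at most `V/α`, and correlations at lag `j` at most `(1 - α)^j V/α`. Summing
the geometric series bounds the mean square of a sum of `N` noise terms by `2NV/α²`
(`IsSample.integral_norm_sq_sum_noise_le`). -/

noncomputable section

set_option linter.unusedSectionVars false

namespace ReBlocK

/-! ### Functions of the past samples, and averaging over a fresh sample. -/

section Adapted

variable {Ω σ G H : Type*}

/-- `Z` is a function of the first `t` samples `S 0, …, S (t - 1)`. -/
def AdaptedAt (S : ℕ → Ω → σ) (t : ℕ) (Z : Ω → G) : Prop :=
  ∃ φ : (Finset.range t → σ) → G, Z = fun ω => φ (fun i => S i ω)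

theorem AdaptedAt.const (S : ℕ → Ω → σ) (t : ℕ) (z : G) : AdaptedAt S t (fun _ => z) :=
  ⟨fun _ => z, rfl⟩

theorem AdaptedAt.prodMk {S : ℕ → Ω → σ} {t : ℕ} {Z : Ω → G} {Y : Ω → H}
    (hZ : AdaptedAt S t Z) (hY : AdaptedAt S t Y) : AdaptedAt S t (fun ω => (Z ω, Y ω)) := by
  obtain ⟨φ, rfl⟩ := hZ
  obtain ⟨ψ, rfl⟩ := hY
  exact ⟨fun a => (φ a, ψ a), rfl⟩

theorem AdaptedAt.comp {S : ℕ → Ω → σ} {t : ℕ} {Z : Ω → G} (hZ : AdaptedAt S t Z) (f : G → H) :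
    AdaptedAt S t (fun ω => f (Z ω)) := by
  obtain ⟨φ, rfl⟩ := hZ
  exact ⟨fun a => f (φ a), rfl⟩

theorem AdaptedAt.mono {S : ℕ → Ω → σ} {s t : ℕ} (hst : s ≤ t) {Z : Ω → G}
    (hZ : AdaptedAt S s Z) : AdaptedAt S t Z := by
  obtain ⟨φ, rfl⟩ := hZ
  exact ⟨fun a => φ (fun i => a ⟨i, by have := i.2; simp only [Finset.mem_range] at *; omega⟩), rfl⟩

theorem AdaptedAt.update {S : ℕ → Ω → σ} {t : ℕ} {Z : Ω → G} (hZ : AdaptedAt S t Z)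
    (F : G → σ → H) : AdaptedAt S (t + 1) (fun ω => F (Z ω) (S t ω)) := by
  obtain ⟨φ, rfl⟩ := hZ
  exact ⟨fun a => F (φ (fun i => a ⟨i, by have := i.2; simp only [Finset.mem_range] at *; omega⟩))
    (a ⟨t, by simp⟩), rfl⟩

variable [MeasurableSpace Ω] [Finite σ] [MeasurableSpace σ] [MeasurableSingletonClass σ]
  [NormedAddCommGroup H] {μ : Measure Ω} [IsProbabilityMeasure μ] {S : ℕ → Ω → σ}

/-- The first `t` samples range over a finite set, so every function of them is integrable and no
regularity of `Z` has to be tracked. -/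
theorem AdaptedAt.integrable (hmeas : ∀ t, Measurable (S t)) {t : ℕ} {Z : Ω → H}
    (hZ : AdaptedAt S t Z) : Integrable Z μ := by
  obtain ⟨φ, rfl⟩ := hZ
  have hm : Measurable (fun ω (i : Finset.range t) => S i ω) :=
    measurable_pi_lambda _ fun i => hmeas i
  have : IsProbabilityMeasure (μ.map (fun ω (i : Finset.range t) => S i ω)) :=
    Measure.isProbabilityMeasure_map hm.aemeasurable
  exact (Integrable.of_finite (f := φ)
    (μ := μ.map (fun ω (i : Finset.range t) => S i ω))).comp_measurable hm

variable [NormedSpace ℝ H] [CompleteSpace H]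

/-- This replaces conditional expectation: independence makes the joint law of the past and `S t` a
product, and Fubini leaves a finite sum over the values of `S t`. -/
theorem AdaptedAt.integral_update [Fintype σ] (hmeas : ∀ t, Measurable (S t))
    (hindep : iIndepFun S μ)
    {p : σ → ℝ} {t : ℕ} (hp : ∀ s, μ.real {ω | S t ω = s} = p s) {Z : Ω → G}
    (hZ : AdaptedAt S t Z) (F : G → σ → H) :
    ∫ ω, F (Z ω) (S t ω) ∂μ = ∑ s, p s • ∫ ω, F (Z ω) s ∂μ := by
  obtain ⟨φ, rfl⟩ := hZ
  set h : Ω → (Finset.range t → σ) := fun ω i => S i ω with hh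
  have hm : Measurable h := measurable_pi_lambda _ fun i => hmeas i
  have hI : IndepFun h (S t) μ := by
    have h1 := hindep.indepFun_finset (Finset.range t) {t} (by simp) hmeas
    exact h1.comp measurable_id (measurable_pi_apply (⟨t, by simp⟩ : ({t} : Finset ℕ)))
  have hprod := (indepFun_iff_map_prod_eq_prod_map_map hm.aemeasurable
    (hmeas t).aemeasurable).1 hI
  have : IsProbabilityMeasure (μ.map h) := Measure.isProbabilityMeasure_map hm.aemeasurable
  have : IsProbabilityMeasure (μ.map (S t)) :=
    Measure.isProbabilityMeasure_map (hmeas t).aemeasurable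
  have e1 : ∫ ω, F (φ (h ω)) (S t ω) ∂μ
      = ∫ z, F (φ z.1) z.2 ∂(μ.map (fun ω => (h ω, S t ω))) := by
    rw [integral_map (hm.prodMk (hmeas t)).aemeasurable]
    exact (StronglyMeasurable.of_discrete).aestronglyMeasurable
  rw [e1, hprod, integral_prod_symm _ Integrable.of_finite, integral_fintype Integrable.of_finite]
  refine Finset.sum_congr rfl fun s _ => ?_
  congr 1
  · rw [measureReal_def, Measure.map_apply (hmeas t) (measurableSet_singleton s), ← hp s]
    rfl
  · rw [integral_map hm.aemeasurable]
    exact (StronglyMeasurable.of_discrete).aestronglyMeasurable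

end Adapted

/-! ### Bias and noise in a random affine recursion. -/

section AffineRecursion

variable {σ E : Type*} [NormedAddCommGroup E] [InnerProductSpace ℝ E]

/-- The random affine recursion `y_{t+1} = (I - P_{S_t}) y_t + g_{S_t}`. -/
def affProc (P : σ → E →L[ℝ] E) (g : σ → E) (y₀ : E) (S : ℕ → σ) : ℕ → E
  | 0 => y₀
  | t + 1 => affProc P g y₀ S t - P (S t) (affProc P g y₀ S t) + g (S t)

/-- Superposition; its use is to separate the initial error (no noise) from the noise (zero start).
-/
theorem affProc_add (P : σ → E →L[ℝ] E) (g h : σ → E) (y z : E) (S : ℕ → σ) (t : ℕ) :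
    affProc P (fun s => g s + h s) (y + z) S t = affProc P g y S t + affProc P h z S t := by
  induction t with
  | zero => rfl
  | succ t ih => simp only [affProc, ih, map_add]; abel

variable [Fintype σ]

/-- The mean operator `∑ p_s P_s`. -/
def avgOp (p : σ → ℝ) (P : σ → E →L[ℝ] E) : E →L[ℝ] E := ∑ s, p s • P s

theorem avgOp_apply (p : σ → ℝ) (P : σ → E →L[ℝ] E) (x : E) :
    avgOp p P x = ∑ s, p s • P s x := by
  simp [avgOp]

/-- Random symmetric operators `P_s` with `P_s² ≤ P_s` and probability weights `p_s`. -/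
structure IsAveraging (p : σ → ℝ) (P : σ → E →L[ℝ] E) : Prop where
  nonneg : ∀ s, 0 ≤ p s
  sum_eq_one : ∑ s, p s = 1
  symm : ∀ s x y, inner ℝ (P s x) y = inner ℝ x (P s y)
  sq_le : ∀ s x, ‖P s x‖ ^ 2 ≤ inner ℝ x (P s x)

/-- Moreover the `P_s` map into the subspace `W`, where their mean is bounded below by `a`. -/
structure IsScheme (p : σ → ℝ) (P : σ → E →L[ℝ] E) (W : Submodule ℝ E) (a : ℝ) : Prop
    extends IsAveraging p P where
  mem : ∀ s x, P s x ∈ W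
  lower : ∀ w ∈ W, a * ‖w‖ ^ 2 ≤ inner ℝ w (avgOp p P w)
  pos : 0 < a
  le_one : a ≤ 1

namespace IsAveraging

variable {p : σ → ℝ} {P : σ → E →L[ℝ] E} (h : IsAveraging p P)

include h

theorem avgOp_symm (x y : E) : inner ℝ (avgOp p P x) y = inner ℝ x (avgOp p P y) := by
  simp only [avgOp_apply, sum_inner, inner_sum, real_inner_smul_left, real_inner_smul_right, h.symm]

theorem norm_le (s : σ) (x : E) : ‖P s x‖ ≤ ‖x‖ := by
  have h1 := (h.sq_le s x).trans (real_inner_le_norm x (P s x))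
  by_contra! hlt
  nlinarith [norm_nonneg x]

theorem inner_le (s : σ) (x : E) : inner ℝ x (P s x) ≤ ‖x‖ ^ 2 :=
  (real_inner_le_norm x (P s x)).trans (by nlinarith [h.norm_le s x, norm_nonneg x])

theorem inner_avgOp (x : E) : inner ℝ x (avgOp p P x) = ∑ s, p s * inner ℝ x (P s x) := by
  simp only [avgOp_apply, inner_sum, real_inner_smul_right]

theorem inner_avgOp_nonneg (x : E) : 0 ≤ inner ℝ x (avgOp p P x) := by
  rw [h.inner_avgOp]
  exact Finset.sum_nonneg fun s _ => mul_nonneg (h.nonneg s) ((sq_nonneg _).trans (h.sq_le s x))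

theorem inner_avgOp_le (x : E) : inner ℝ x (avgOp p P x) ≤ ‖x‖ ^ 2 := by
  rw [h.inner_avgOp]
  calc ∑ s, p s * inner ℝ x (P s x) ≤ ∑ s, p s * ‖x‖ ^ 2 :=
        Finset.sum_le_sum fun s _ => mul_le_mul_of_nonneg_left (h.inner_le s x) (h.nonneg s)
    _ = ‖x‖ ^ 2 := by rw [← Finset.sum_mul, h.sum_eq_one, one_mul]

end IsAveraging

namespace IsScheme

variable {p : σ → ℝ} {P : σ → E →L[ℝ] E} {W : Submodule ℝ E} {a : ℝ} (h : IsScheme p P W a)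

include h

theorem avgOp_mem (x : E) : avgOp p P x ∈ W := by
  rw [avgOp_apply]
  exact W.sum_mem fun s _ => W.smul_mem _ (h.mem s x)

/-- `B = I - P̄` is symmetric, preserves `W`, and has its quadratic form between `0` and `1 - a`
there. The norm bound comes from positivity of `B` at `t • w - B w`, a Cauchy–Schwarz argument that
avoids the spectral theorem. -/
theorem norm_sub_avgOp_le {w : E} (hw : w ∈ W) : ‖w - avgOp p P w‖ ≤ (1 - a) * ‖w‖ := by
  set B : E →L[ℝ] E := ContinuousLinearMap.id ℝ E - avgOp p P with hB
  have hBa : ∀ x, B x = x - avgOp p P x := fun x => rfl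
  have hBW : ∀ x ∈ W, B x ∈ W := fun x hx => W.sub_mem hx (h.avgOp_mem x)
  have hsymm : ∀ x y, inner ℝ (B x) y = inner ℝ x (B y) := fun x y => by
    simp only [hBa, inner_sub_left, inner_sub_right, h.avgOp_symm]
  have hpos : ∀ x, 0 ≤ inner ℝ x (B x) := fun x => by
    rw [hBa, inner_sub_right, real_inner_self_eq_norm_sq]
    linarith [h.inner_avgOp_le x]
  have hup : ∀ x ∈ W, inner ℝ x (B x) ≤ (1 - a) * ‖x‖ ^ 2 := fun x hx => by
    rw [hBa, inner_sub_right, real_inner_self_eq_norm_sq]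
    linarith [h.lower x hx]
  have hexp : ∀ t : ℝ, 0 ≤ t ^ 2 * inner ℝ w (B w) - 2 * t * ‖B w‖ ^ 2
      + inner ℝ (B w) (B (B w)) := fun t => by
    have h1 := hpos (t • w - B w)
    have e : inner ℝ (t • w - B w) (B (t • w - B w)) = t ^ 2 * inner ℝ w (B w)
        - 2 * t * ‖B w‖ ^ 2 + inner ℝ (B w) (B (B w)) := by
      simp only [map_sub, map_smul, inner_sub_left, inner_sub_right, real_inner_smul_left,
        real_inner_smul_right, real_inner_self_eq_norm_sq]
      rw [← hsymm w (B w), real_inner_self_eq_norm_sq]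
      ring
    rwa [e] at h1
  have h1 := hup w hw
  have h2 := hup (B w) (hBW w hw)
  have ha := h.le_one
  have key : ‖B w‖ ^ 2 ≤ ((1 - a) * ‖w‖) ^ 2 := by
    -- The choice `t = 1 - a` gives `‖B w‖² ≤ (1 - a) ⟪w, B w⟫` after division by `1 - a`. If `a =
    -- 1` the form vanishes on `W`, and `t = 1` forces `B w = 0`.
    rcases ha.lt_or_eq with hlt | rfl
    · have h3 := hexp (1 - a)
      have h4 : 0 ≤ (1 - a) * ((1 - a) * inner ℝ w (B w) - ‖B w‖ ^ 2) := by nlinarith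
      have h5 := nonneg_of_mul_nonneg_right h4 (by linarith : 0 < 1 - a)
      nlinarith
    · have h3 := hexp 1
      nlinarith
  exact abs_le_of_sq_le_sq' key (mul_nonneg (by linarith) (norm_nonneg _)) |>.2

/-- In `‖w - P w‖² = ‖w‖² - 2⟪w, P w⟫ + ‖P w‖²` the last term is absorbed by one of the two inner
products, by `P² ≤ P`. -/
theorem sum_norm_sub_sq_le {w : E} (hw : w ∈ W) :
    ∑ s, p s * ‖w - P s w‖ ^ 2 ≤ (1 - a) * ‖w‖ ^ 2 := by
  have h1 := h.lower w hw
  rw [avgOp_apply, inner_sum] at h1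
  calc ∑ s, p s * ‖w - P s w‖ ^ 2 ≤ ∑ s, (p s * ‖w‖ ^ 2 - inner ℝ w (p s • P s w)) :=
        Finset.sum_le_sum fun s _ => by
          rw [real_inner_smul_right, ← mul_sub, norm_sub_sq_real]
          exact mul_le_mul_of_nonneg_left (by linarith [h.sq_le s w]) (h.nonneg s)
    _ ≤ (1 - a) * ‖w‖ ^ 2 := by
        rw [Finset.sum_sub_distrib, ← Finset.sum_mul, h.sum_eq_one]
        linarith

end IsScheme

theorem IsScheme.affProc_mem {p : σ → ℝ} {P : σ → E →L[ℝ] E} {W : Submodule ℝ E} {a : ℝ}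
    (h : IsScheme p P W a) {g : σ → E} (hg : ∀ s, g s ∈ W) {y₀ : E} (hy : y₀ ∈ W) (S : ℕ → σ)
    (t : ℕ) : affProc P g y₀ S t ∈ W := by
  induction t with
  | zero => exact hy
  | succ t ih => exact W.add_mem (W.sub_mem ih (h.mem _ _)) (hg _)

variable {Ω : Type*} [MeasurableSpace Ω] [MeasurableSpace σ] [MeasurableSingletonClass σ]
  {μ : Measure Ω} [IsProbabilityMeasure μ] {S : ℕ → Ω → σ} {p : σ → ℝ}

theorem adaptedAt_affProc (P : σ → E →L[ℝ] E) (g : σ → E) (y₀ : E) (S : ℕ → Ω → σ) (t : ℕ) :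
    AdaptedAt S t (fun ω => affProc P g y₀ (fun u => S u ω) t) := by
  induction t with
  | zero => exact AdaptedAt.const S 0 y₀
  | succ t ih => exact ih.update (fun y s => y - P s y + g s)

/-- The samples are independent and each has law `p`. -/
structure IsSample (μ : Measure Ω) (S : ℕ → Ω → σ) (p : σ → ℝ) : Prop where
  meas : ∀ t, Measurable (S t)
  indep : iIndepFun S μ
  law : ∀ t s, μ.real {ω | S t ω = s} = p s

variable [CompleteSpace E]

theorem IsSample.integral_affProc_succ (hS : IsSample μ S p) (hp : ∑ s, p s = 1)
    (P : σ → E →L[ℝ] E) {g : σ → E} (hg : ∑ s, p s • g s = 0) (y₀ : E) (t : ℕ) :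
    ∫ ω, affProc P g y₀ (fun u => S u ω) (t + 1) ∂μ
      = (∫ ω, affProc P g y₀ (fun u => S u ω) t ∂μ)
        - avgOp p P (∫ ω, affProc P g y₀ (fun u => S u ω) t ∂μ) := by
  have hA := adaptedAt_affProc P g y₀ S t
  have hi : Integrable (fun ω => affProc P g y₀ (fun u => S u ω) t) μ := hA.integrable hS.meas
  have h1 := hA.integral_update hS.meas hS.indep (hS.law t) (fun y s => y - P s y + g s)
  refine h1.trans ?_
  have h2 : ∀ s, ∫ ω, (affProc P g y₀ (fun u => S u ω) t
      - P s (affProc P g y₀ (fun u => S u ω) t) + g s) ∂μ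
      = (∫ ω, affProc P g y₀ (fun u => S u ω) t ∂μ)
        - P s (∫ ω, affProc P g y₀ (fun u => S u ω) t ∂μ) + g s := fun s => by
    have hi2 := (P s).integrable_comp hi
    have hi3 : Integrable (fun ω => affProc P g y₀ (fun u => S u ω) t
      - P s (affProc P g y₀ (fun u => S u ω) t)) μ := hi.sub hi2
    rw [integral_add hi3 (integrable_const _), integral_sub hi hi2,
      (P s).integral_comp_comm hi]
    simp
  simp only [h2, smul_add, smul_sub, Finset.sum_add_distrib, Finset.sum_sub_distrib, hg, add_zero,
    ← Finset.sum_smul, hp, one_smul, avgOp_apply]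

/-- The contraction holds only on `W`, so the induction also carries membership of the mean in `W`.
-/
theorem IsSample.norm_integral_affProc_le (hS : IsSample μ S p) {P : σ → E →L[ℝ] E}
    {W : Submodule ℝ E} {a : ℝ} (h : IsScheme p P W a) {g : σ → E}
    (hg : ∑ s, p s • g s = 0) {y₀ : E} (hy : y₀ ∈ W) (t : ℕ) :
    ‖∫ ω, affProc P g y₀ (fun u => S u ω) t ∂μ‖ ≤ (1 - a) ^ t * ‖y₀‖ := by
  suffices hs : (∫ ω, affProc P g y₀ (fun u => S u ω) t ∂μ) ∈ W ∧
      ‖∫ ω, affProc P g y₀ (fun u => S u ω) t ∂μ‖ ≤ (1 - a) ^ t * ‖y₀‖ from hs.2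
  induction t with
  | zero => simpa [affProc] using hy
  | succ t ih =>
    rw [hS.integral_affProc_succ h.sum_eq_one P hg]
    refine ⟨W.sub_mem ih.1 (h.avgOp_mem _), (h.norm_sub_avgOp_le ih.1).trans ?_⟩
    have h0 : 0 ≤ 1 - a := by linarith [h.le_one]
    calc (1 - a) * _ ≤ (1 - a) * ((1 - a) ^ t * ‖y₀‖) := mul_le_mul_of_nonneg_left ih.2 h0
      _ = _ := by ring

theorem IsSample.integral_norm_sq_bias_le (hS : IsSample μ S p) {P : σ → E →L[ℝ] E}
    {W : Submodule ℝ E} {a : ℝ} (h : IsScheme p P W a) {y₀ : E} (hy : y₀ ∈ W) (t : ℕ) :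
    ∫ ω, ‖affProc P (fun _ => 0) y₀ (fun u => S u ω) t‖ ^ 2 ∂μ ≤ (1 - a) ^ t * ‖y₀‖ ^ 2 := by
  induction t with
  | zero => simp [affProc]
  | succ t ih =>
    have hA := adaptedAt_affProc P (fun _ => 0) y₀ S t
    have h1 := hA.integral_update hS.meas hS.indep (hS.law t) (fun y s => ‖y - P s y + 0‖ ^ 2)
    have h0 : 0 ≤ 1 - a := by linarith [h.le_one]
    have hint : ∀ s, Integrable (fun ω =>
        ‖affProc P (fun _ => 0) y₀ (fun u => S u ω) t
          - P s (affProc P (fun _ => 0) y₀ (fun u => S u ω) t) + 0‖ ^ 2) μ := fun s =>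
      (hA.comp (fun y => ‖y - P s y + 0‖ ^ 2)).integrable hS.meas
    refine h1.le.trans ?_
    simp only [smul_eq_mul, ← integral_const_mul]
    rw [← integral_finsetSum _ fun s _ => (hint s).const_mul _]
    calc _ ≤ ∫ ω, (1 - a) * ‖affProc P (fun _ => 0) y₀ (fun u => S u ω) t‖ ^ 2 ∂μ := by
          refine integral_mono (integrable_finsetSum _ fun s _ => (hint s).const_mul _)
            ((hA.comp (fun y => (1 - a) * ‖y‖ ^ 2)).integrable hS.meas) fun ω => ?_
          simp only [add_zero]
          exact h.sum_norm_sub_sq_le (h.affProc_mem (fun _ => W.zero_mem) hy _ t)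
      _ ≤ _ := by
          rw [integral_const_mul, pow_succ']
          linarith [mul_le_mul_of_nonneg_left ih h0]

/-! ### Second moments and correlations of the noise started at zero. -/

section Noise

variable {P : σ → E →L[ℝ] E} {W : Submodule ℝ E} {a : ℝ} {g : σ → E}

theorem IsSample.integral_noise_eq_zero (hS : IsSample μ S p) (hp : ∑ s, p s = 1)
    (P : σ → E →L[ℝ] E) (hg : ∑ s, p s • g s = 0) (t : ℕ) :
    ∫ ω, affProc P g 0 (fun u => S u ω) t ∂μ = 0 := by
  induction t with
  | zero => simp [affProc]
  | succ t ih => rw [hS.integral_affProc_succ hp P hg, ih]; simp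

theorem IsSample.integral_norm_sq_noise_succ_le (hS : IsSample μ S p) (h : IsScheme p P W a)
    (hgW : ∀ s, g s ∈ W) (hg : ∑ s, p s • g s = 0) (t : ℕ) :
    ∫ ω, ‖affProc P g 0 (fun u => S u ω) (t + 1)‖ ^ 2 ∂μ
      ≤ (1 - a) * (∫ ω, ‖affProc P g 0 (fun u => S u ω) t‖ ^ 2 ∂μ)
        + ∑ s, p s * ‖g s‖ ^ 2 := by
  have hA := adaptedAt_affProc P g 0 S t
  set n : Ω → E := fun ω => affProc P g 0 (fun u => S u ω) t with hn
  have h1 := hA.integral_update hS.meas hS.indep (hS.law t) (fun y s => ‖y - P s y + g s‖ ^ 2)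
  refine h1.le.trans ?_
  -- By symmetry of `P s`, the averaged cross term is `2⟪v, n⟫` with `v` deterministic; it
  -- integrates to zero because `n` has mean zero.
  set v : E := ∑ s, p s • (g s - P s (g s)) with hv
  have hint : ∀ s, Integrable (fun ω => ‖n ω - P s (n ω) + g s‖ ^ 2) μ := fun s =>
    (hA.comp (fun y => ‖y - P s y + g s‖ ^ 2)).integrable hS.meas
  have hint1 : Integrable (fun ω => (1 - a) * ‖n ω‖ ^ 2) μ :=
    (hA.comp (fun y => (1 - a) * ‖y‖ ^ 2)).integrable hS.meas
  have hint2 : Integrable (fun ω => 2 * inner ℝ v (n ω)) μ :=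
    (hA.comp (fun y => 2 * inner ℝ v y)).integrable hS.meas
  simp only [smul_eq_mul, ← integral_const_mul]
  rw [← integral_finsetSum _ fun s _ => (hint s).const_mul _]
  calc _ ≤ ∫ ω, ((1 - a) * ‖n ω‖ ^ 2 + 2 * inner ℝ v (n ω) + ∑ s, p s * ‖g s‖ ^ 2) ∂μ := by
        refine integral_mono (integrable_finsetSum _ fun s _ => (hint s).const_mul _)
          ((hint1.add hint2).add (integrable_const _)) fun ω => ?_
        have hw := h.sum_norm_sub_sq_le (h.affProc_mem hgW W.zero_mem (fun u => S u ω) t)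
        have e : ∑ s, p s * ‖n ω - P s (n ω) + g s‖ ^ 2
            = ∑ s, p s * ‖n ω - P s (n ω)‖ ^ 2 + 2 * inner ℝ v (n ω)
              + ∑ s, p s * ‖g s‖ ^ 2 := by
          rw [hv, sum_inner, Finset.mul_sum, ← Finset.sum_add_distrib, ← Finset.sum_add_distrib]
          refine Finset.sum_congr rfl fun s _ => ?_
          rw [norm_add_sq_real, real_inner_smul_left, inner_sub_left, inner_sub_left, h.symm,
            real_inner_comm (n ω) (g s), real_inner_comm (n ω) (P s (g s))]
          ring
        simp only at e ⊢
        rw [e]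
        linarith
    _ = (1 - a) * (∫ ω, ‖n ω‖ ^ 2 ∂μ) + 2 * inner ℝ v (∫ ω, n ω ∂μ)
          + ∑ s, p s * ‖g s‖ ^ 2 := by
        have hint3 : Integrable (fun ω => (1 - a) * ‖n ω‖ ^ 2 + 2 * inner ℝ v (n ω)) μ :=
          hint1.add hint2
        rw [integral_add hint3 (integrable_const _), integral_add hint1 hint2,
          integral_const_mul, integral_const_mul]
        have : ∫ ω, inner ℝ v (n ω) ∂μ = inner ℝ v (∫ ω, n ω ∂μ) :=
          integral_inner (hA.integrable hS.meas) v
        rw [this]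
        simp
    _ = _ := by
        rw [hn, hS.integral_noise_eq_zero h.sum_eq_one P hg]
        simp only [inner_zero_right, mul_zero, add_zero, integral_const_mul]

/-- `V / a` is the fixed point of the one-step bound `u ↦ (1 - a) u + V`, and the process starts
below it. -/
theorem IsSample.integral_norm_sq_noise_le (hS : IsSample μ S p) (h : IsScheme p P W a)
    (hgW : ∀ s, g s ∈ W) (hg : ∑ s, p s • g s = 0) (t : ℕ) :
    ∫ ω, ‖affProc P g 0 (fun u => S u ω) t‖ ^ 2 ∂μ ≤ (∑ s, p s * ‖g s‖ ^ 2) / a := by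
  have ha := h.pos
  have hV : 0 ≤ ∑ s, p s * ‖g s‖ ^ 2 :=
    Finset.sum_nonneg fun s _ => mul_nonneg (h.nonneg s) (sq_nonneg _)
  induction t with
  | zero => simpa [affProc] using div_nonneg hV ha.le
  | succ t ih =>
    refine (hS.integral_norm_sq_noise_succ_le h hgW hg t).trans ?_
    have h0 : 0 ≤ 1 - a := by linarith [h.le_one]
    have h1 := mul_le_mul_of_nonneg_left ih h0
    have h2 : (1 - a) * ((∑ s, p s * ‖g s‖ ^ 2) / a) + ∑ s, p s * ‖g s‖ ^ 2
        = (∑ s, p s * ‖g s‖ ^ 2) / a := by field_simp; ring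
    linarith

/-- The conditional mean of the noise decays: `E⟨Z, n_{t+j}⟩ = E⟨(I - P̄)^j Z, n_t⟩`. -/
theorem IsSample.integral_inner_noise_add (hS : IsSample μ S p) (h : IsScheme p P W a)
    (hg : ∑ s, p s • g s = 0) (t j : ℕ) {Z : Ω → E} (hZ : AdaptedAt S t Z) :
    ∫ ω, inner ℝ (Z ω) (affProc P g 0 (fun u => S u ω) (t + j)) ∂μ
      = ∫ ω, inner ℝ (((ContinuousLinearMap.id ℝ E - avgOp p P) ^ j) (Z ω))
          (affProc P g 0 (fun u => S u ω) t) ∂μ := by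
  induction j generalizing Z with
  | zero => simp
  | succ j ih =>
    have hA := adaptedAt_affProc P g 0 S (t + j)
    have hZA := (hZ.mono (Nat.le_add_right t j)).prodMk hA
    have h1 := hZA.integral_update hS.meas hS.indep (hS.law (t + j))
      (fun z s => inner ℝ z.1 (z.2 - P s z.2 + g s))
    -- Averaging over the newest sample applies `I - P̄` to the process; symmetry moves it onto `Z`,
    -- which stays adapted at time `t`. Hence the induction over all `Z`.
    have h2 := ih (hZ.comp (ContinuousLinearMap.id ℝ E - avgOp p P))
    rw [pow_succ]
    refine Eq.trans ?_ h2
    refine h1.trans ?_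
    simp only [smul_eq_mul, ← integral_const_mul]
    rw [← integral_finsetSum _ fun s _ =>
      (hZA.comp fun z => p s * inner ℝ z.1 (z.2 - P s z.2 + g s)).integrable hS.meas]
    refine integral_congr_ae (Filter.Eventually.of_forall fun ω => ?_)
    simp only [sub_apply, ContinuousLinearMap.id_apply, inner_sub_left,
      h.avgOp_symm]
    simp only [inner_add_right, inner_sub_right, mul_add, mul_sub, Finset.sum_add_distrib,
      Finset.sum_sub_distrib, ← Finset.sum_mul, h.sum_eq_one, one_mul, avgOp_apply, inner_sum,
      real_inner_smul_right]
    have hz : ∑ s, p s * inner ℝ (Z ω) (g s) = 0 := by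
      simpa [inner_sum, real_inner_smul_right] using congrArg (inner ℝ (Z ω)) hg
    rw [hz, add_zero]

theorem IsScheme.norm_pow_le (h : IsScheme p P W a) {w : E} (hw : w ∈ W) (j : ℕ) :
    ‖((ContinuousLinearMap.id ℝ E - avgOp p P) ^ j) w‖ ≤ (1 - a) ^ j * ‖w‖ := by
  induction j generalizing w with
  | zero => simp
  | succ j ih =>
    rw [pow_succ]
    refine (ih (W.sub_mem hw (h.avgOp_mem w))).trans ?_
    rw [pow_succ, mul_assoc]
    exact mul_le_mul_of_nonneg_left (h.norm_sub_avgOp_le hw)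
      (pow_nonneg (by linarith [h.le_one]) _)

theorem IsSample.integral_inner_noise_le (hS : IsSample μ S p) (h : IsScheme p P W a)
    (hgW : ∀ s, g s ∈ W) (hg : ∑ s, p s • g s = 0) (t j : ℕ) :
    ∫ ω, inner ℝ (affProc P g 0 (fun u => S u ω) t)
        (affProc P g 0 (fun u => S u ω) (t + j)) ∂μ
      ≤ (1 - a) ^ j * ((∑ s, p s * ‖g s‖ ^ 2) / a) := by
  have hA := adaptedAt_affProc P g 0 S t
  rw [hS.integral_inner_noise_add h hg t j hA]
  have h0 : 0 ≤ (1 - a) ^ j := pow_nonneg (by linarith [h.le_one]) _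
  calc _ ≤ ∫ ω, (1 - a) ^ j * ‖affProc P g 0 (fun u => S u ω) t‖ ^ 2 ∂μ := by
        refine integral_mono ((hA.comp fun y => inner ℝ
          (((ContinuousLinearMap.id ℝ E - avgOp p P) ^ j) y) y).integrable hS.meas)
          ((hA.comp fun y => (1 - a) ^ j * ‖y‖ ^ 2).integrable hS.meas) fun ω => ?_
        have hw := h.norm_pow_le (h.affProc_mem hgW W.zero_mem (fun u => S u ω) t) j
        refine (real_inner_le_norm _ _).trans ?_
        simp only [pow_two, ← mul_assoc]
        exact mul_le_mul_of_nonneg_right hw (norm_nonneg _)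
    _ ≤ _ := by
        rw [integral_const_mul]
        exact mul_le_mul_of_nonneg_left (hS.integral_norm_sq_noise_le h hgW hg t) h0

theorem sum_pow_le {a : ℝ} (ha : 0 < a) (ha1 : a ≤ 1) (Tb N : ℕ) :
    ∑ s ∈ Finset.Icc (Tb + 1) (Tb + N), (1 - a) ^ (Tb + N + 1 - s) ≤ (1 - a) / a := by
  induction N with
  | zero => simpa using div_nonneg (by linarith : 0 ≤ 1 - a) ha.le
  | succ N ih =>
    rw [← add_assoc, Finset.sum_Icc_succ_top (by omega)]
    have e : ∑ s ∈ Finset.Icc (Tb + 1) (Tb + N), (1 - a) ^ (Tb + N + 1 + 1 - s)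
        = (1 - a) * ∑ s ∈ Finset.Icc (Tb + 1) (Tb + N), (1 - a) ^ (Tb + N + 1 - s) := by
      rw [Finset.mul_sum]
      refine Finset.sum_congr rfl fun s hs => ?_
      rw [Finset.mem_Icc] at hs
      rw [← pow_succ']
      congr 1
      omega
    have h1 := mul_le_mul_of_nonneg_left ih (by linarith : 0 ≤ 1 - a)
    have h2 : (1 - a) * ((1 - a) / a) + (1 - a) = (1 - a) / a := by field_simp; ring
    rw [e, show Tb + N + 1 + 1 - (Tb + N + 1) = 1 by omega, pow_one]
    linarith

theorem adaptedAt_sum_affProc (P : σ → E →L[ℝ] E) (g : σ → E) (y₀ : E) (S : ℕ → Ω → σ)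
    (Tb T : ℕ) :
    AdaptedAt S T (fun ω => ∑ t ∈ Finset.Icc (Tb + 1) T, affProc P g y₀ (fun u => S u ω) t) := by
  have : ∀ t, ∃ φ : (Finset.range T → σ) → E, t ∈ Finset.Icc (Tb + 1) T →
      (fun ω => affProc P g y₀ (fun u => S u ω) t) = fun ω => φ (fun i => S i ω) := fun t => by
    by_cases ht : t ∈ Finset.Icc (Tb + 1) T
    · obtain ⟨φ, hφ⟩ := (adaptedAt_affProc P g y₀ S t).mono (Finset.mem_Icc.1 ht).2
      exact ⟨φ, fun _ => hφ⟩
    · exact ⟨fun _ => 0, fun h => absurd h ht⟩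
  choose φ hφ using this
  refine ⟨fun b => ∑ t ∈ Finset.Icc (Tb + 1) T, φ t b, funext fun ω => ?_⟩
  exact Finset.sum_congr rfl fun t ht => congrFun (hφ t ht) ω

/-- Each new summand adds its own second moment and twice its correlation with the earlier ones; the
latter is a geometric sum, so the increment is bounded independently of `N`. -/
theorem IsSample.integral_norm_sq_sum_noise_le (hS : IsSample μ S p) (h : IsScheme p P W a)
    (hgW : ∀ s, g s ∈ W) (hg : ∑ s, p s • g s = 0) (Tb N : ℕ) :
    ∫ ω, ‖∑ t ∈ Finset.Icc (Tb + 1) (Tb + N), affProc P g 0 (fun u => S u ω) t‖ ^ 2 ∂μ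
      ≤ N * (2 / a * ((∑ s, p s * ‖g s‖ ^ 2) / a)) := by
  have ha := h.pos
  set v := (∑ s, p s * ‖g s‖ ^ 2) / a with hv
  have hv0 : 0 ≤ v := div_nonneg
    (Finset.sum_nonneg fun s _ => mul_nonneg (h.nonneg s) (sq_nonneg _)) ha.le
  induction N with
  | zero => simp
  | succ N ih =>
    have hM := (adaptedAt_sum_affProc P g 0 S Tb (Tb + N)).mono (Nat.le_succ _)
    have hn := adaptedAt_affProc P g 0 S (Tb + N + 1)
    have hMn := hM.prodMk hn
    set M : Ω → E := fun ω =>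
      ∑ t ∈ Finset.Icc (Tb + 1) (Tb + N), affProc P g 0 (fun u => S u ω) t with hMdef
    set n : Ω → E := fun ω => affProc P g 0 (fun u => S u ω) (Tb + N + 1) with hndef
    have i1 : Integrable (fun ω => ‖M ω‖ ^ 2) μ := (hM.comp fun y => ‖y‖ ^ 2).integrable hS.meas
    have i2 : Integrable (fun ω => 2 * inner ℝ (M ω) (n ω)) μ :=
      (hMn.comp fun y => 2 * inner ℝ y.1 y.2).integrable hS.meas
    have i3 : Integrable (fun ω => ‖n ω‖ ^ 2) μ := (hn.comp fun y => ‖y‖ ^ 2).integrable hS.meas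
    have hcross : ∫ ω, inner ℝ (M ω) (n ω) ∂μ ≤ (1 - a) / a * v := by
      have e : ∀ ω, inner ℝ (M ω) (n ω) = ∑ t ∈ Finset.Icc (Tb + 1) (Tb + N),
          inner ℝ (affProc P g 0 (fun u => S u ω) t) (n ω) := fun ω => sum_inner _ _ _
      simp only [e]
      rw [integral_finsetSum]
      · calc _ ≤ ∑ t ∈ Finset.Icc (Tb + 1) (Tb + N), (1 - a) ^ (Tb + N + 1 - t) * v := by
              refine Finset.sum_le_sum fun t ht => ?_
              rw [Finset.mem_Icc] at ht
              have := hS.integral_inner_noise_le h hgW hg t (Tb + N + 1 - t)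
              rwa [show t + (Tb + N + 1 - t) = Tb + N + 1 by omega] at this
          _ ≤ _ := by
              rw [← Finset.sum_mul]
              exact mul_le_mul_of_nonneg_right (sum_pow_le ha h.le_one Tb N) hv0
      · intro t ht
        rw [Finset.mem_Icc] at ht
        exact ((((adaptedAt_affProc P g 0 S t).mono (by omega : t ≤ Tb + N + 1)).prodMk hn).comp
          fun y => inner ℝ y.1 y.2).integrable hS.meas
    have hsq := hS.integral_norm_sq_noise_le h hgW hg (Tb + N + 1)
    have e : ∀ ω, ‖∑ t ∈ Finset.Icc (Tb + 1) (Tb + (N + 1)), affProc P g 0 (fun u => S u ω) t‖ ^ 2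
        = ‖M ω‖ ^ 2 + 2 * inner ℝ (M ω) (n ω) + ‖n ω‖ ^ 2 := fun ω => by
      rw [← add_assoc, Finset.sum_Icc_succ_top (by omega), norm_add_sq_real]
    simp only [e]
    have i12 : Integrable (fun ω => ‖M ω‖ ^ 2 + 2 * inner ℝ (M ω) (n ω)) μ := i1.add i2
    rw [integral_add i12 i3, integral_add i1 i2, integral_const_mul]
    -- The left side equals `2v/a - v`; discarding `-v` gives the clean constant.
    have h2 : 2 * ((1 - a) / a * v) + v ≤ 2 / a * v := by
      have : 2 / a * v = 2 * ((1 - a) / a * v) + 2 * v := by field_simp; ring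
      linarith
    push_cast
    linarith

end Noise

theorem norm_sum_sq_le_card_mul {ι : Type*} (s : Finset ι) (f : ι → E) :
    ‖∑ i ∈ s, f i‖ ^ 2 ≤ s.card * ∑ i ∈ s, ‖f i‖ ^ 2 :=
  (pow_le_pow_left₀ (norm_nonneg _) (norm_sum_le _ _) 2).trans (sq_sum_le_card_mul_sum_sq)

theorem IsSample.integral_norm_sq_sum_le (hS : IsSample μ S p) {P : σ → E →L[ℝ] E}
    {W : Submodule ℝ E} {a : ℝ} (h : IsScheme p P W a) {g : σ → E} (hgW : ∀ s, g s ∈ W)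
    (hg : ∑ s, p s • g s = 0) {y₀ : E} (hy : y₀ ∈ W) (Tb N : ℕ) :
    ∫ ω, ‖∑ t ∈ Finset.Icc (Tb + 1) (Tb + N), affProc P g y₀ (fun u => S u ω) t‖ ^ 2 ∂μ
      ≤ 2 * (N ^ 2 * ((1 - a) ^ (Tb + 1) * ‖y₀‖ ^ 2))
        + 2 * (N * (2 / a * ((∑ s, p s * ‖g s‖ ^ 2) / a))) := by
  have h0 : 0 ≤ 1 - a := by linarith [h.le_one]
  have h01 : 1 - a ≤ 1 := by linarith [h.pos]
  have hsplit : ∀ ω t, affProc P g y₀ (fun u => S u ω) t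
      = affProc P (fun _ => 0) y₀ (fun u => S u ω) t + affProc P g 0 (fun u => S u ω) t :=
    fun ω t => by simpa using affProc_add P (fun _ => 0) g y₀ 0 (fun u => S u ω) t
  have hB := hS.integral_norm_sq_bias_le h hy
  have iB : ∀ t, Integrable
      (fun ω => ‖affProc P (fun _ => 0) y₀ (fun u => S u ω) t‖ ^ 2) μ := fun t =>
    ((adaptedAt_affProc P (fun _ => 0) y₀ S t).comp fun y => ‖y‖ ^ 2).integrable hS.meas
  have iS : ∀ (g : σ → E) (y : E), Integrable (fun ω =>
      ‖∑ t ∈ Finset.Icc (Tb + 1) (Tb + N), affProc P g y (fun u => S u ω) t‖ ^ 2) μ := fun g y =>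
    ((adaptedAt_sum_affProc P g y S Tb (Tb + N)).comp fun y => ‖y‖ ^ 2).integrable hS.meas
  have iBs : Integrable (fun ω => ∑ t ∈ Finset.Icc (Tb + 1) (Tb + N),
      ‖affProc P (fun _ => 0) y₀ (fun u => S u ω) t‖ ^ 2) μ :=
    integrable_finsetSum _ fun t _ => iB t
  calc _ ≤ ∫ ω, (2 * (N * ∑ t ∈ Finset.Icc (Tb + 1) (Tb + N),
          ‖affProc P (fun _ => 0) y₀ (fun u => S u ω) t‖ ^ 2)
        + 2 * ‖∑ t ∈ Finset.Icc (Tb + 1) (Tb + N), affProc P g 0 (fun u => S u ω) t‖ ^ 2) ∂μ := by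
        refine integral_mono (iS g y₀) (((iBs.const_mul _).const_mul _).add
          ((iS g 0).const_mul _)) fun ω => ?_
        simp only [hsplit ω, Finset.sum_add_distrib]
        have h1 := norm_sum_sq_le_card_mul (Finset.Icc (Tb + 1) (Tb + N))
          (fun t => affProc P (fun _ => 0) y₀ (fun u => S u ω) t)
        rw [Nat.card_Icc, show Tb + N + 1 - (Tb + 1) = N by omega] at h1
        generalize (∑ t ∈ Finset.Icc (Tb + 1) (Tb + N),
          affProc P (fun _ => 0) y₀ (fun u => S u ω) t) = x at *
        generalize (∑ t ∈ Finset.Icc (Tb + 1) (Tb + N),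
          affProc P g 0 (fun u => S u ω) t) = z at *
        -- The factor `2` in front of both bias and noise comes from `‖x + z‖² ≤ 2‖x‖² + 2‖z‖²`.
        have h2 := parallelogram_law_with_norm ℝ x z
        nlinarith [norm_nonneg (x - z), mul_self_nonneg ‖x - z‖]
    _ ≤ _ := by
        rw [integral_add ((iBs.const_mul _).const_mul _) ((iS g 0).const_mul _),
          integral_const_mul, integral_const_mul, integral_const_mul,
          integral_finsetSum _ fun t _ => iB t]
        have h1 : ∑ t ∈ Finset.Icc (Tb + 1) (Tb + N),
            ∫ ω, ‖affProc P (fun _ => 0) y₀ (fun u => S u ω) t‖ ^ 2 ∂μ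
            ≤ N * ((1 - a) ^ (Tb + 1) * ‖y₀‖ ^ 2) := by
          refine (Finset.sum_le_card_nsmul _ _ ((1 - a) ^ (Tb + 1) * ‖y₀‖ ^ 2)
            fun t ht => ?_).trans (le_of_eq ?_)
          · rw [Finset.mem_Icc] at ht
            exact (hB t).trans (mul_le_mul_of_nonneg_right
              (pow_le_pow_of_le_one h0 h01 ht.1) (sq_nonneg _))
          · rw [Nat.card_Icc, show Tb + N + 1 - (Tb + 1) = N by omega, nsmul_eq_mul]
        have h2 := mul_le_mul_of_nonneg_left h1 (Nat.cast_nonneg (α := ℝ) N)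
        have h3 := hS.integral_norm_sq_sum_noise_le h hgW hg Tb N
        have e : (N : ℝ) * (N * ((1 - a) ^ (Tb + 1) * ‖y₀‖ ^ 2))
          = N ^ 2 * ((1 - a) ^ (Tb + 1) * ‖y₀‖ ^ 2) := by ring
        linarith

end AffineRecursion

/-! ### Sums of principal minors and their orthogonal invariance. -/

section Minors

open Matrix

variable {ι : Type*} [Fintype ι] [DecidableEq ι]

/-- The principal submatrix of `M` with rows and columns in `S`. -/
abbrev principal (M : Matrix ι ι ℝ) (S : Finset ι) : Matrix S S ℝ :=
  M.submatrix (fun i : S => (i : ι)) (fun i : S => (i : ι))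

/-- The sum of all principal minors of size `k`. -/
def minorSum (M : Matrix ι ι ℝ) (k : ℕ) : ℝ :=
  ∑ S ∈ Finset.univ.powersetCard k, (principal M S).det

/-- Up to sign the sum is a coefficient of the characteristic polynomial, a similarity invariant.
For `k` above the dimension both sums are empty. -/
theorem minorSum_conj {U : Matrix ι ι ℝ} (hU : Uᵀ * U = 1) (M : Matrix ι ι ℝ) (k : ℕ) :
    minorSum (U * M * Uᵀ) k = minorSum M k := by
  by_cases hk : k ≤ Fintype.card ι
  · have h1 := charpoly_coeff_eq_sum_minors (U * M * Uᵀ) k hk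
    have h2 := charpoly_coeff_eq_sum_minors M k hk
    have h3 : (U * M * Uᵀ).charpoly = M.charpoly := by
      rw [Matrix.mul_assoc, Matrix.charpoly_mul_comm, Matrix.mul_assoc, hU, Matrix.mul_one]
    rw [h3, h2] at h1
    exact (mul_left_cancel₀ (pow_ne_zero k (by norm_num)) h1).symm
  · have : (Finset.univ : Finset ι).powersetCard k = ∅ :=
      Finset.powersetCard_eq_empty.2 (by rw [Finset.card_univ]; omega)
    simp [minorSum, this]

theorem det_add_vecMulVec {N : Matrix ι ι ℝ} (hN : IsUnit N.det) (v : ι → ℝ) :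
    (N + vecMulVec v v).det = N.det * (1 + v ⬝ᵥ N⁻¹ *ᵥ v) := by
  have h := Matrix.det_add_replicateCol_mul_replicateRow (ι := Unit) hN v v
  rw [← vecMulVec_eq] at h
  rw [h, det_unique (n := Unit), Matrix.add_apply, Matrix.mul_assoc, ← replicateCol_mulVec,
    replicateRow_mul_replicateCol_apply, one_apply_eq]

/-- The form `∑_{|S| = k} det M_S · u_Sᵀ M_S⁻¹ v_S`. -/
def minorForm (M : Matrix ι ι ℝ) (k : ℕ) (u v : ι → ℝ) : ℝ :=
  ∑ S ∈ Finset.univ.powersetCard k, (principal M S).det *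
    ((fun i : S => u i) ⬝ᵥ (principal M S)⁻¹ *ᵥ (fun i : S => v i))

/-- A rank-one update restricts to a rank-one update of every block, so the determinant lemma
applies blockwise. This exhibits `minorForm` as a difference of two orthogonal invariants. -/
theorem minorSum_add_vecMulVec {M : Matrix ι ι ℝ} (hM : M.PosDef) (k : ℕ) (v : ι → ℝ) :
    minorSum (M + vecMulVec v v) k = minorSum M k + minorForm M k v v := by
  rw [minorSum, minorSum, minorForm, ← Finset.sum_add_distrib]
  refine Finset.sum_congr rfl fun S _ => ?_
  have hS : (principal M S).PosDef := hM.submatrix Subtype.val_injective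
  have e : principal (M + vecMulVec v v) S
      = principal M S + vecMulVec (fun i : S => v i) (fun i : S => v i) := rfl
  rw [e, det_add_vecMulVec hS.det_pos.ne'.isUnit]
  ring

theorem minorForm_add (M : Matrix ι ι ℝ) (k : ℕ) (u v w : ι → ℝ) :
    minorForm M k (u + v) w = minorForm M k u w + minorForm M k v w := by
  simp only [minorForm, ← Finset.sum_add_distrib, ← mul_add]
  refine Finset.sum_congr rfl fun S _ => ?_
  rw [← add_dotProduct]
  rfl

theorem minorForm_comm {M : Matrix ι ι ℝ} (hM : M.IsSymm) (k : ℕ) (u v : ι → ℝ) :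
    minorForm M k u v = minorForm M k v u := by
  refine Finset.sum_congr rfl fun S _ => ?_
  have hS : ((principal M S)⁻¹)ᵀ = (principal M S)⁻¹ := by
    rw [transpose_nonsing_inv, transpose_submatrix, hM.eq]
  rw [dotProduct_mulVec, ← mulVec_transpose, hS, dotProduct_comm]

/-- The weight `d_i⁻¹ ∑_{|S| = k, i ∈ S} ∏_{j ∈ S} d_j`. -/
def minorWeight (d : ι → ℝ) (k : ℕ) (i : ι) : ℝ :=
  (∑ S ∈ (Finset.univ.powersetCard k).filter (i ∈ ·), ∏ j ∈ S, d j) / d i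

theorem principal_diagonal (d : ι → ℝ) (S : Finset ι) :
    principal (diagonal d) S = diagonal (fun i : S => d i) :=
  submatrix_diagonal d _ Subtype.val_injective

theorem det_principal_diagonal (d : ι → ℝ) (S : Finset ι) :
    (principal (diagonal d) S).det = ∏ j ∈ S, d j := by
  rw [principal_diagonal, det_diagonal]
  exact Finset.prod_coe_sort S d

theorem minorForm_diagonal {d : ι → ℝ} (hd : ∀ i, 0 < d i) (k : ℕ) (v : ι → ℝ) :
    minorForm (diagonal d) k v v = ∑ i, v i ^ 2 * minorWeight d k i := by
  have h1 : ∀ S : Finset ι, (fun i : S => v i) ⬝ᵥ (principal (diagonal d) S)⁻¹ *ᵥ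
      (fun i : S => v i) = ∑ i ∈ S, v i ^ 2 / d i := fun S => by
    have hinv : (principal (diagonal d) S)⁻¹ = diagonal (fun i : S => (d i)⁻¹) := by
      rw [principal_diagonal]
      refine inv_eq_right_inv ?_
      rw [diagonal_mul_diagonal, ← diagonal_one]
      congr 1
      funext i
      exact mul_inv_cancel₀ (hd i).ne'
    rw [hinv, ← Finset.sum_coe_sort S]
    refine Finset.sum_congr rfl fun i _ => ?_
    rw [mulVec_diagonal]
    ring
  have h2 : ∀ i, v i ^ 2 * minorWeight d k i = ∑ S ∈ Finset.univ.powersetCard k,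
      if i ∈ S then (∏ j ∈ S, d j) * (v i ^ 2 / d i) else 0 := fun i => by
    rw [minorWeight, ← Finset.sum_filter, ← Finset.sum_mul]
    ring
  simp only [minorForm, h1, h2, det_principal_diagonal]
  rw [Finset.sum_comm]
  refine Finset.sum_congr rfl fun S _ => ?_
  rw [Finset.sum_ite_mem, Finset.univ_inter, Finset.mul_sum]

theorem posDef_conj_diagonal {U : Matrix ι ι ℝ} (hU : Uᵀ * U = 1) {d : ι → ℝ}
    (hd : ∀ i, 0 < d i) : (U * diagonal d * Uᵀ).PosDef := by
  have h1 : (diagonal d).PosDef := PosDef.diagonal hd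
  have hu : IsUnit U := by
    rw [isUnit_iff_isUnit_det]
    exact isUnit_det_of_left_inverse hU
  have := (Matrix.IsUnit.posDef_star_right_conjugate_iff hu (x := diagonal d)).2 h1
  rwa [star_eq_conjTranspose, conjTranspose_eq_transpose_of_trivial] at this

theorem minorForm_conj_self {U : Matrix ι ι ℝ} (hU : Uᵀ * U = 1) {d : ι → ℝ}
    (hd : ∀ i, 0 < d i) (k : ℕ) (v : ι → ℝ) :
    minorForm (U * diagonal d * Uᵀ) k v v = ∑ i, (Uᵀ *ᵥ v) i ^ 2 * minorWeight d k i := by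
  have hU' : U * Uᵀ = 1 := mul_eq_one_comm.1 hU
  have h1 := minorSum_add_vecMulVec (posDef_conj_diagonal hU hd) k v
  have e : U * diagonal d * Uᵀ + vecMulVec v v
      = U * (diagonal d + vecMulVec (Uᵀ *ᵥ v) (Uᵀ *ᵥ v)) * Uᵀ := by
    rw [Matrix.mul_add, Matrix.add_mul, mul_vecMulVec, vecMulVec_mul, mulVec_mulVec, hU',
      one_mulVec, ← mulVec_transpose, transpose_transpose, mulVec_mulVec, hU', one_mulVec]
  rw [e, minorSum_conj hU, minorSum_conj hU, minorSum_add_vecMulVec (PosDef.diagonal hd),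
    minorForm_diagonal hd] at h1
  linarith

/-- Polarization of the diagonal case; the off-diagonal values are what the mean-zero property of
the noise needs. -/
theorem minorForm_conj {U : Matrix ι ι ℝ} (hU : Uᵀ * U = 1) {d : ι → ℝ}
    (hd : ∀ i, 0 < d i) (k : ℕ) (u v : ι → ℝ) :
    minorForm (U * diagonal d * Uᵀ) k u v
      = ∑ i, (Uᵀ *ᵥ u) i * (Uᵀ *ᵥ v) i * minorWeight d k i := by
  have hs : (U * diagonal d * Uᵀ).IsSymm := by
    simp [Matrix.IsSymm, transpose_mul, Matrix.mul_assoc]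
  have h1 := minorForm_conj_self hU hd k (u + v)
  rw [minorForm_add, minorForm_comm hs k u (u + v), minorForm_comm hs k v (u + v), minorForm_add,
    minorForm_add, minorForm_comm hs k v u, minorForm_conj_self hU hd, minorForm_conj_self hU hd,
    mulVec_add] at h1
  have h2 : ∑ i, (Uᵀ *ᵥ u + Uᵀ *ᵥ v) i ^ 2 * minorWeight d k i
      = ∑ i, (Uᵀ *ᵥ u) i ^ 2 * minorWeight d k i + ∑ i, (Uᵀ *ᵥ v) i ^ 2 * minorWeight d k i
        + 2 * ∑ i, (Uᵀ *ᵥ u) i * (Uᵀ *ᵥ v) i * minorWeight d k i := by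
    rw [Finset.mul_sum, ← Finset.sum_add_distrib, ← Finset.sum_add_distrib]
    refine Finset.sum_congr rfl fun i _ => ?_
    rw [Pi.add_apply]
    ring
  linarith

theorem minorWeight_pos {d : ι → ℝ} (hd : ∀ i, 0 < d i) {k : ℕ} (hk : 1 ≤ k)
    (hk' : k ≤ Fintype.card ι) (i : ι) : 0 < minorWeight d k i := by
  refine div_pos (Finset.sum_pos (fun S _ => Finset.prod_pos fun j _ => hd j) ?_) (hd i)
  obtain ⟨S, h1, -, h2⟩ := Finset.exists_subsuperset_card_eq (Finset.subset_univ ({i} : Finset ι))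
    (n := k) (by simpa using hk) (by simpa using hk')
  exact ⟨S, by simp [h2, Finset.singleton_subset_iff.1 h1]⟩

/-- Exchanging `j` for `i` maps these sets injectively into the `k`-sets containing `i` and
multiplies the product by `d i / d j`. -/
theorem sum_swap_le {d : ι → ℝ} (hd : ∀ i, 0 < d i) (k : ℕ) (i j : ι) :
    ∑ S ∈ (Finset.univ.powersetCard k).filter (fun S => i ∉ S ∧ j ∈ S), ∏ x ∈ S, d x
      ≤ d j * minorWeight d k i := by
  have h1 : ∀ S ∈ (Finset.univ.powersetCard k).filter (fun S => i ∉ S ∧ j ∈ S),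
      ∏ x ∈ S, d x = d j / d i * ∏ x ∈ insert i (S.erase j), d x := fun S hS => by
    simp only [Finset.mem_filter] at hS
    rw [Finset.prod_insert (fun h => hS.2.1 (Finset.mem_of_mem_erase h)),
      ← Finset.mul_prod_erase S d hS.2.2]
    field_simp [(hd i).ne']
  rw [Finset.sum_congr rfl h1, ← Finset.mul_sum, minorWeight, ← mul_div_assoc, div_mul_eq_mul_div]
  refine div_le_div_of_nonneg_right (mul_le_mul_of_nonneg_left ?_ (hd j).le) (hd i).le
  refine (Finset.sum_image (f := fun S => ∏ x ∈ S, d x)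
    (g := fun S : Finset ι => insert i (S.erase j)) ?_).symm.le.trans ?_
  rotate_left
  · refine Finset.sum_le_sum_of_subset_of_nonneg ?_ fun S _ _ =>
      Finset.prod_nonneg fun x _ => (hd x).le
    intro S' hS'
    obtain ⟨S, hS, rfl⟩ := Finset.mem_image.1 hS'
    simp only [Finset.mem_filter, Finset.mem_powersetCard] at hS ⊢
    refine ⟨⟨Finset.subset_univ _, ?_⟩, Finset.mem_insert_self _ _⟩
    rw [Finset.card_insert_of_notMem (fun h => hS.2.1 (Finset.mem_of_mem_erase h)),
      Finset.card_erase_add_one hS.2.2]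
    exact hS.1.2
  · intro S hS S' hS' he
    simp only [Finset.coe_filter, Set.mem_ofPred_eq] at hS hS'
    have h2 : (insert i (S.erase j)).erase i = (insert i (S'.erase j)).erase i :=
      congrArg (Finset.erase · i) he
    rw [Finset.erase_insert (fun h => hS.2.1 (Finset.mem_of_mem_erase h)),
      Finset.erase_insert (fun h => hS'.2.1 (Finset.mem_of_mem_erase h))] at h2
    rw [← Finset.insert_erase hS.2.2, h2, Finset.insert_erase hS'.2.2]

/-- The elementary symmetric polynomial ratio bound behind the spectral estimate. -/
theorem minorSum_diagonal_le {d : ι → ℝ} (hd : ∀ i, 0 < d i) (k : ℕ) (T : Finset ι) (i : ι) :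
    ((k : ℝ) - T.card) * minorSum (diagonal d) k
      ≤ minorWeight d k i * (((k : ℝ) - T.card) * d i + ∑ j ∈ Tᶜ, d j) := by
  have hZ : minorSum (diagonal d) k = d i * minorWeight d k i
      + ∑ S ∈ (Finset.univ.powersetCard k).filter (fun S => i ∉ S), ∏ x ∈ S, d x := by
    simp only [minorSum, det_principal_diagonal, minorWeight]
    rw [mul_div_cancel₀ _ (hd i).ne', Finset.sum_filter_add_sum_filter_not]
  have h1 : ((k : ℝ) - T.card) *
      ∑ S ∈ (Finset.univ.powersetCard k).filter (fun S => i ∉ S), ∏ x ∈ S, d x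
      ≤ ∑ S ∈ (Finset.univ.powersetCard k).filter (fun S => i ∉ S),
        ∑ j ∈ Tᶜ, if j ∈ S then ∏ x ∈ S, d x else 0 := by
    rw [Finset.mul_sum]
    refine Finset.sum_le_sum fun S hS => ?_
    rw [← Finset.sum_filter, Finset.sum_const, nsmul_eq_mul]
    refine mul_le_mul_of_nonneg_right ?_ (Finset.prod_nonneg fun x _ => (hd x).le)
    simp only [Finset.mem_filter, Finset.mem_powersetCard] at hS
    -- A `k`-set has at least `k - |T|` elements outside `T`, so counting it once per such element
    -- overcounts by at least that factor.
    have h2 : S.card ≤ (Tᶜ.filter (· ∈ S)).card + T.card := by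
      refine (Finset.card_le_card (t := Tᶜ.filter (· ∈ S) ∪ T) fun x hx => ?_).trans
        (Finset.card_union_le _ _)
      by_cases hT : x ∈ T <;> simp [hT, hx]
    rw [hS.1.2] at h2
    have : (k : ℝ) ≤ (Tᶜ.filter (· ∈ S)).card + T.card := by exact_mod_cast h2
    linarith
  have h3 : ∑ S ∈ (Finset.univ.powersetCard k).filter (fun S => i ∉ S),
        (∑ j ∈ Tᶜ, if j ∈ S then ∏ x ∈ S, d x else 0) ≤ minorWeight d k i * ∑ j ∈ Tᶜ, d j := by
    rw [Finset.sum_comm, Finset.mul_sum]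
    refine Finset.sum_le_sum fun j _ => ?_
    rw [← Finset.sum_filter, Finset.filter_filter, mul_comm]
    exact sum_swap_le hd k i j
  rw [hZ, mul_add]
  linarith

end Minors

/-! ### Singular vectors, and singular values of positive operators. -/

section Singular

open Module

/-- The vectors `σ_i⁻¹ T v_i` with `i` below the rank are orthonormal; any completion works, since
the added vectors are orthogonal to the range and so are killed by the adjoint. -/
theorem exists_leftSingularBasis {m n : ℕ}
    (T : EuclideanSpace ℝ (Fin n) →ₗ[ℝ] EuclideanSpace ℝ (Fin m)) :
    ∃ u : OrthonormalBasis (Fin m) ℝ (EuclideanSpace ℝ (Fin m)),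
      ∀ i, T (T.adjoint (u i)) = T.singularValues i ^ 2 • u i := by
  have hn : finrank ℝ (EuclideanSpace ℝ (Fin n)) = n := by simp
  have hm : finrank ℝ (EuclideanSpace ℝ (Fin m)) = Fintype.card (Fin m) := by simp
  set r := finrank ℝ (LinearMap.range T) with hr
  have hrn : r ≤ n := by simpa using LinearMap.finrank_range_le T
  have hrm : r ≤ m := by simpa using Submodule.finrank_le (LinearMap.range T)
  set v := T.isSymmetric_adjoint_comp_self.eigenvectorBasis hn with hv
  have hTv : ∀ i, T.adjoint (T (v i)) = T.singularValues i ^ 2 • v i := fun i => by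
    have h := T.isSymmetric_adjoint_comp_self.apply_eigenvectorBasis hn i
    rw [← T.sq_singularValues_fin hn i] at h
    exact h
  have hin : ∀ i j, inner ℝ (T (v i)) (T (v j)) = if i = j then T.singularValues j ^ 2 else 0 := by
    intro i j
    rw [← LinearMap.adjoint_inner_right, hTv, real_inner_smul_right,
      orthonormal_iff_ite.1 v.orthonormal]
    simp
  -- The value `0` for `i ≥ n` is never used: only indices below the rank, which is at most `n`,
  -- enter the orthonormal family.
  set f : Fin m → EuclideanSpace ℝ (Fin m) := fun i =>
    if h : (i : ℕ) < n then (T.singularValues i)⁻¹ • T (v ⟨i, h⟩) else 0 with hf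
  have hfi : ∀ (i : Fin m) (h : (i : ℕ) < r),
      f i = (T.singularValues i)⁻¹ • T (v ⟨i, h.trans_le hrn⟩) := fun i h =>
    dif_pos (h.trans_le hrn)
  have hpos : ∀ i : ℕ, i < r → 0 < T.singularValues i := fun i hi =>
    T.singularValues_pos_iff_lt_finrank_range.2 hi
  have hzero : ∀ i : ℕ, r ≤ i → T.singularValues i = 0 := fun i hi =>
    T.singularValues_eq_zero_iff_le_finrank_range.2 hi
  have hort : Orthonormal ℝ (({i : Fin m | (i : ℕ) < r}).domRestrict f) := by
    rw [orthonormal_iff_ite]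
    rintro ⟨i, hi⟩ ⟨j, hj⟩
    simp only [Set.mem_ofPred_eq] at hi hj
    change inner ℝ (f i) (f j) = _
    rw [hfi i hi, hfi j hj, real_inner_smul_left, real_inner_smul_right, hin]
    by_cases hij : i = j
    · subst hij
      have := (hpos i hi).ne'
      simp
      field_simp
    · have h1 : (i : ℕ) ≠ j := fun h => hij (Fin.ext h)
      simp [hij, h1]
  obtain ⟨u, hu⟩ := hort.exists_orthonormalBasis_extension_of_card_eq hm
  refine ⟨u, fun i => ?_⟩
  by_cases hi : (i : ℕ) < r
  · rw [hu i hi, hfi i hi]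
    simp only [map_smul, hTv, smul_smul]
    rw [mul_comm]
  · push Not at hi
    have h0 : T.adjoint (u i) = 0 := by
      rw [← v.sum_repr' (T.adjoint (u i))]
      refine Finset.sum_eq_zero fun j _ => ?_
      rw [LinearMap.adjoint_inner_right]
      by_cases hj : (j : ℕ) < r
      · have h1 : inner ℝ (u ⟨j, hj.trans_le hrm⟩) (u i) = (0 : ℝ) := u.orthonormal.2
          (fun h => by rw [← h] at hi; exact absurd hj (not_lt.2 hi))
        rw [hu ⟨j, hj.trans_le hrm⟩ hj, hfi ⟨j, hj.trans_le hrm⟩ hj, real_inner_smul_left] at h1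
        rw [(mul_eq_zero.1 h1).resolve_left (inv_ne_zero (hpos j hj).ne'), zero_smul]
      · have h1 := hin j j
        rw [if_pos rfl, hzero j (not_lt.1 hj), real_inner_self_eq_norm_sq] at h1
        have h2 : T (v j) = 0 := norm_eq_zero.1 (by simpa using h1)
        rw [h2, inner_zero_left, zero_smul]
    rw [h0, hzero i hi]
    simp

variable {E : Type*} [NormedAddCommGroup E] [InnerProductSpace ℝ E] [FiniteDimensional ℝ E]

/-- From `T² v = s² v`, the vector `T v - s v` satisfies `T w = -s w`; positivity of `T` with `s >
0` makes it vanish. -/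
theorem exists_eigenvector_of_singularValue {T : E →ₗ[ℝ] E} (hT : T.IsSymmetric)
    (hpos : ∀ x, 0 ≤ inner ℝ x (T x)) {i : ℕ} (hi : T.singularValues i ≠ 0) :
    ∃ v ≠ 0, T v = T.singularValues i • v := by
  have hlt : i < finrank ℝ E := by
    by_contra! h
    exact hi (T.singularValues_of_finrank_le h)
  obtain ⟨v, hv⟩ := (T.hasEigenvalue_adjoint_comp_self_sq_singularValues hlt).exists_hasEigenvector
  refine ⟨v, hv.2, ?_⟩
  have h1 : T (T v) = T.singularValues i ^ 2 • v := by
    have := hv.apply_eq_smul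
    rwa [LinearMap.comp_apply, hT.adjoint_eq]
      at this
  set s := T.singularValues i
  have hs : 0 < s := lt_of_le_of_ne (T.singularValues_nonneg i) (Ne.symm hi)
  have h2 : T (T v - s • v) = -s • (T v - s • v) := by
    rw [map_sub, map_smul, h1, smul_sub, smul_smul, neg_smul]
    module
  have h3 := hpos (T v - s • v)
  rw [h2, real_inner_smul_right, real_inner_self_eq_norm_sq] at h3
  have h4 : ‖T v - s • v‖ ^ 2 = 0 := by
    refine le_antisymm ?_ (sq_nonneg _)
    by_contra! h
    nlinarith
  exact sub_eq_zero.1 (norm_eq_zero.1 (pow_eq_zero_iff two_ne_zero |>.1 h4))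

theorem exists_singularValue_eq_of_eigenvector {T : E →ₗ[ℝ] E} (hT : T.IsSymmetric)
    {a : ℝ} (ha : 0 ≤ a) {v : E} (hv : v ≠ 0) (hTv : T v = a • v) :
    ∃ i, T.singularValues i = a := by
  have h1 : End.HasEigenvalue (T.adjoint ∘ₗ T) (a ^ 2) := by
    refine End.hasEigenvalue_of_hasEigenvector (x := v) ⟨?_, hv⟩
    rw [End.mem_eigenspace_iff, LinearMap.comp_apply,
      hT.adjoint_eq, hTv, map_smul, hTv, smul_smul,
      pow_two]
  obtain ⟨i, hi⟩ := T.isSymmetric_adjoint_comp_self.exists_eigenvalues_eq rfl h1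
  refine ⟨i, ?_⟩
  rw [T.singularValues_fin rfl, show T.isSymmetric_adjoint_comp_self.eigenvalues rfl i = a ^ 2 from hi,
    Real.sqrt_sq ha]

/-- The nonzero singular values of `T`. -/
def posSingularValues (T : E →ₗ[ℝ] E) : Set ℝ :=
  {s : ℝ | s ≠ 0 ∧ ∃ j : ℕ, 1 ≤ j ∧ s = T.singularValues (j - 1)}

/-- Only finitely many singular values are nonzero, so the infimum is attained and has an
eigenvector when `T` is symmetric and positive. -/
theorem sInf_posSingularValues_mem {T : E →ₗ[ℝ] E} (hT : T ≠ 0) :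
    sInf (posSingularValues T) ∈ posSingularValues T := by
  refine Set.Nonempty.csInf_mem ?_ ?_
  · by_contra! h
    refine hT (T.singularValues_eq_zero_iff.1 (Finsupp.ext fun i => ?_))
    by_contra hi
    exact (h ▸ (⟨hi, i + 1, by omega, by simp⟩ : T.singularValues i ∈ posSingularValues T) :
      T.singularValues i ∈ (∅ : Set ℝ))
  · refine (T.singularValues.support.finite_toSet.image T.singularValues).subset ?_
    rintro s ⟨hs, j, -, rfl⟩
    exact ⟨j - 1, Finsupp.mem_support_iff.2 hs, rfl⟩

/-- In an eigenbasis, orthogonality to the kernel removes the zero-eigenvalue coordinates, and every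
positive eigenvalue is a singular value. -/
theorem sInf_posSingularValues_mul_le {T : E →ₗ[ℝ] E} (hT : T.IsSymmetric)
    (hpos : ∀ x, 0 ≤ inner ℝ x (T x)) {x : E} (hx : x ∈ (LinearMap.ker T)ᗮ) :
    sInf (posSingularValues T) * ‖x‖ ^ 2 ≤ inner ℝ x (T x) := by
  set b := hT.eigenvectorBasis rfl with hb
  have hTb : ∀ i, T (b i) = hT.eigenvalues rfl i • b i := fun i => hT.apply_eigenvectorBasis rfl i
  have hbdd : BddBelow (posSingularValues T) :=
    ⟨0, by rintro s ⟨-, j, -, rfl⟩; exact T.singularValues_nonneg _⟩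
  have h1 : inner ℝ x (T x) = ∑ i, hT.eigenvalues rfl i * inner ℝ (b i) x ^ 2 := by
    rw [← b.sum_inner_mul_inner x (T x)]
    refine Finset.sum_congr rfl fun i _ => ?_
    rw [← hT, hTb, real_inner_smul_left, real_inner_comm x (b i)]
    ring
  have h2 : ‖x‖ ^ 2 = ∑ i, inner ℝ (b i) x ^ 2 := by
    rw [← b.sum_sq_norm_inner_right x]
    simp
  rw [h1, h2, Finset.mul_sum]
  refine Finset.sum_le_sum fun i _ => ?_
  have h3 : 0 ≤ hT.eigenvalues rfl i := by
    have := hpos (b i)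
    rw [hTb, real_inner_smul_right, real_inner_self_eq_norm_sq, b.orthonormal.1 i] at this
    simpa using this
  rcases h3.eq_or_lt with h4 | h4
  · have : b i ∈ LinearMap.ker T := by
      rw [LinearMap.mem_ker, hTb, ← h4, zero_smul]
    rw [(Submodule.mem_orthogonal _ _).1 hx _ this]
    simp
  · obtain ⟨j, hj⟩ := exists_singularValue_eq_of_eigenvector hT h3 (b.toBasis.ne_zero i)
      (by simpa using hTb i)
    refine mul_le_mul_of_nonneg_right (csInf_le hbdd ⟨h4.ne', j + 1, by omega, ?_⟩) (sq_nonneg _)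
    simpa using hj.symm

end Singular

/-! ### Regularized inverses for a single block. -/

section Ridge

open Matrix

theorem inner_eq_dotProduct {κ : Type*} [Fintype κ] (x y : EuclideanSpace ℝ κ) :
    inner ℝ x y = x.ofLp ⬝ᵥ y.ofLp := by
  rw [EuclideanSpace.inner_eq_star_dotProduct, dotProduct_comm]
  simp

theorem norm_sq_eq_dotProduct {κ : Type*} [Fintype κ] (x : EuclideanSpace ℝ κ) :
    ‖x‖ ^ 2 = x.ofLp ⬝ᵥ x.ofLp := by
  rw [← real_inner_self_eq_norm_sq, inner_eq_dotProduct]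

variable {κ ν : Type*} [Fintype κ] [DecidableEq κ] [Fintype ν]

theorem posDef_mul_transpose_add (B : Matrix κ ν ℝ) {c : ℝ} (hc : 0 < c) :
    (B * Bᵀ + c • (1 : Matrix κ κ ℝ)).PosDef := by
  have h1 : (B * Bᵀ).PosSemidef := by
    have := posSemidef_self_mul_conjTranspose B
    rwa [conjTranspose_eq_transpose_of_trivial] at this
  exact PosDef.posSemidef_add h1 (PosDef.one.smul hc)

theorem transpose_inv_ridge (B : Matrix κ ν ℝ) (c : ℝ) :
    ((B * Bᵀ + c • (1 : Matrix κ κ ℝ))⁻¹)ᵀ = (B * Bᵀ + c • (1 : Matrix κ κ ℝ))⁻¹ := by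
  rw [transpose_nonsing_inv]
  simp [transpose_mul]

/-- `y = (B Bᵀ + c I)⁻¹ z` solves `B Bᵀ y + c y = z`. -/
theorem ridge_mulVec_inv (B : Matrix κ ν ℝ) {c : ℝ} (hc : 0 < c) (z : κ → ℝ) :
    B *ᵥ (Bᵀ *ᵥ ((B * Bᵀ + c • (1 : Matrix κ κ ℝ))⁻¹ *ᵥ z))
      + c • ((B * Bᵀ + c • (1 : Matrix κ κ ℝ))⁻¹ *ᵥ z) = z := by
  have hu := (posDef_mul_transpose_add B hc).det_pos.ne'.isUnit
  generalize hy : (B * Bᵀ + c • (1 : Matrix κ κ ℝ))⁻¹ *ᵥ z = y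
  have : (B * Bᵀ + c • (1 : Matrix κ κ ℝ)) *ᵥ y = z := by
    rw [← hy, mulVec_mulVec, mul_nonsing_inv _ hu, one_mulVec]
  rw [← this, add_mulVec, smul_mulVec, one_mulVec, mulVec_mulVec]

theorem dotProduct_mulVec_transpose (B : Matrix κ ν ℝ) (x : ν → ℝ) (y : κ → ℝ) :
    x ⬝ᵥ Bᵀ *ᵥ y = (B *ᵥ x) ⬝ᵥ y := by
  rw [dotProduct_mulVec, vecMul_transpose]

/-- With `y` the ridge solution for `B x`, `⟪B x, y⟫ = ‖Bᵀ y‖² + c‖y‖²`. This is `P² ≤ P`. -/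
theorem ridge_contraction (B : Matrix κ ν ℝ) {c : ℝ} (hc : 0 < c) (x : ν → ℝ) :
    (Bᵀ *ᵥ ((B * Bᵀ + c • (1 : Matrix κ κ ℝ))⁻¹ *ᵥ (B *ᵥ x))) ⬝ᵥ
        (Bᵀ *ᵥ ((B * Bᵀ + c • (1 : Matrix κ κ ℝ))⁻¹ *ᵥ (B *ᵥ x)))
      ≤ x ⬝ᵥ Bᵀ *ᵥ ((B * Bᵀ + c • (1 : Matrix κ κ ℝ))⁻¹ *ᵥ (B *ᵥ x)) := by
  have h := ridge_mulVec_inv B hc (B *ᵥ x)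
  generalize (B * Bᵀ + c • (1 : Matrix κ κ ℝ))⁻¹ *ᵥ (B *ᵥ x) = y at *
  rw [dotProduct_mulVec_transpose B x y, ← h, add_dotProduct, smul_dotProduct,
    ← dotProduct_mulVec_transpose B]
  have : 0 ≤ y ⬝ᵥ y := Finset.sum_nonneg fun i _ => mul_self_nonneg _
  simp only [smul_eq_mul]
  nlinarith

/-- Arithmetic–geometric mean: `‖B Bᵀ y + c y‖² ≥ 4c ⟪B Bᵀ y, y⟫`, the operator form of `s / (s² +
c) ≤ 1 / (2√c)`. -/
theorem ridge_gain_le (B : Matrix κ ν ℝ) {c : ℝ} (hc : 0 < c) (z : κ → ℝ) :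
    (Bᵀ *ᵥ ((B * Bᵀ + c • (1 : Matrix κ κ ℝ))⁻¹ *ᵥ z)) ⬝ᵥ
        (Bᵀ *ᵥ ((B * Bᵀ + c • (1 : Matrix κ κ ℝ))⁻¹ *ᵥ z)) ≤ 1 / (4 * c) * (z ⬝ᵥ z) := by
  have h := ridge_mulVec_inv B hc z
  generalize (B * Bᵀ + c • (1 : Matrix κ κ ℝ))⁻¹ *ᵥ z = y at *
  have h1 : 0 ≤ (B *ᵥ (Bᵀ *ᵥ y) - c • y) ⬝ᵥ (B *ᵥ (Bᵀ *ᵥ y) - c • y) :=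
    Finset.sum_nonneg fun i _ => mul_self_nonneg _
  have h2 : (Bᵀ *ᵥ y) ⬝ᵥ (Bᵀ *ᵥ y) = (B *ᵥ (Bᵀ *ᵥ y)) ⬝ᵥ y := dotProduct_mulVec_transpose B _ y
  rw [h2, ← h]
  have h3 := dotProduct_comm y (B *ᵥ (Bᵀ *ᵥ y))
  simp only [sub_dotProduct, dotProduct_sub, smul_dotProduct, dotProduct_smul, smul_eq_mul,
    add_dotProduct, dotProduct_add] at h1 ⊢
  rw [div_mul_eq_mul_div, le_div_iff₀ (by positivity)]
  rw [h3] at h1 ⊢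
  linarith

end Ridge

/-! ### The determinantal law expressed through principal minors. -/

section DPP

open Matrix

variable {m n : ℕ} (A : Matrix (Fin m) (Fin n) ℝ) (lam : ℝ) (k : ℕ)

/-- `A Aᵀ + λ k I`. -/
def ridgeGram : Matrix (Fin m) (Fin m) ℝ := A * Aᵀ + (lam * k) • (1 : Matrix (Fin m) (Fin m) ℝ)

theorem regGram_eq_principal (S : Finset (Fin m)) :
    regGram A lam k S = principal (ridgeGram A lam k) S := by
  ext i j
  simp only [regGram, ridgeGram, principal, submatrix_apply, Matrix.add_apply, Matrix.smul_apply,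
    Matrix.one_apply, Subtype.val_inj]
  rfl

variable {lam k}

theorem det_regGram_pos (hc : 0 < lam * k) (S : Finset (Fin m)) : 0 < (regGram A lam k S).det :=
  (posDef_mul_transpose_add (rowBlock A S) hc).det_pos

theorem minorSum_ridgeGram :
    minorSum (ridgeGram A lam k) k
      = ∑ S' ∈ Finset.powersetCard k (Finset.univ : Finset (Fin m)), (regGram A lam k S').det := by
  simp only [minorSum, regGram_eq_principal]

theorem minorSum_ridgeGram_pos (hc : 0 < lam * k) (hkm : k ≤ m) :
    0 < minorSum (ridgeGram A lam k) k := by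
  rw [minorSum_ridgeGram]
  refine Finset.sum_pos (fun S _ => det_regGram_pos A hc S) ?_
  rw [Finset.powersetCard_nonempty]
  simpa using hkm

theorem sum_dppProb_mul (f : Finset (Fin m) → ℝ) :
    ∑ S, dppProb A lam k S * f S
      = (∑ S ∈ Finset.univ.powersetCard k, (principal (ridgeGram A lam k) S).det * f S)
        / minorSum (ridgeGram A lam k) k := by
  have h : (Finset.univ : Finset (Fin m)).powersetCard k
      = Finset.univ.filter (fun S => S.card = k) := by
    ext S; simp [Finset.mem_powersetCard]
  rw [Finset.sum_div, h, Finset.sum_filter]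
  refine Finset.sum_congr rfl fun S _ => ?_
  simp only [dppProb, minorSum_ridgeGram, regGram_eq_principal]
  split_ifs <;> ring

theorem dppProb_nonneg (hc : 0 < lam * k) (S : Finset (Fin m)) : 0 ≤ dppProb A lam k S := by
  unfold dppProb
  split_ifs
  · exact div_nonneg (det_regGram_pos A hc S).le
      (Finset.sum_nonneg fun S _ => (det_regGram_pos A hc S).le)
  · exact le_rfl

theorem sum_dppProb (hc : 0 < lam * k) (hkm : k ≤ m) : ∑ S, dppProb A lam k S = 1 := by
  have h := sum_dppProb_mul A (lam := lam) (k := k) (fun _ => 1)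
  simp only [mul_one] at h
  rw [h]
  exact div_self (minorSum_ridgeGram_pos A hc hkm).ne'

theorem sum_dppProb_mul_form (u v : Fin m → ℝ) :
    ∑ S : Finset (Fin m), dppProb A lam k S *
        ((fun i : S => u i) ⬝ᵥ (regGram A lam k S)⁻¹ *ᵥ (fun i : S => v i))
      = minorForm (ridgeGram A lam k) k u v / minorSum (ridgeGram A lam k) k := by
  rw [sum_dppProb_mul]
  simp only [regGram_eq_principal, minorForm]

theorem rowBlock_mulVec (S : Finset (Fin m)) (x : Fin n → ℝ) :
    rowBlock A S *ᵥ x = fun i : S => (A *ᵥ x) i := rfl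

theorem dotProduct_gain (S : Finset (Fin m)) (x : Fin n → ℝ) (z : S → ℝ) :
    x ⬝ᵥ gain A lam k S *ᵥ z
      = (fun i : S => (A *ᵥ x) i) ⬝ᵥ (regGram A lam k S)⁻¹ *ᵥ z := by
  rw [gain, ← mulVec_mulVec, dotProduct_mulVec_transpose, rowBlock_mulVec]

theorem dotProduct_meanProj (x y : Fin n → ℝ) :
    x ⬝ᵥ meanProj A lam k *ᵥ y
      = minorForm (ridgeGram A lam k) k (A *ᵥ x) (A *ᵥ y) / minorSum (ridgeGram A lam k) k := by
  rw [← sum_dppProb_mul_form, meanProj, sum_mulVec, dotProduct_sum]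
  refine Finset.sum_congr rfl fun S _ => ?_
  rw [smul_mulVec, dotProduct_smul, ← mulVec_mulVec, dotProduct_gain, rowBlock_mulVec, smul_eq_mul]

/-- Left singular vectors diagonalize `A Aᵀ`, with the squared singular values on the diagonal. -/
theorem exists_leftSingularMatrix :
    ∃ U : Matrix (Fin m) (Fin m) ℝ, Uᵀ * U = 1 ∧
      (Uᵀ * A) * (Uᵀ * A)ᵀ = diagonal (fun i : Fin m => sigma A (i + 1) ^ 2) := by
  obtain ⟨u, hu⟩ := exists_leftSingularBasis (Matrix.toEuclideanLin A)
  rw [← Matrix.toEuclideanLin_conjTranspose_eq_adjoint,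
    conjTranspose_eq_transpose_of_trivial] at hu
  have ho : ∀ i j, (u i).ofLp ⬝ᵥ (u j).ofLp = if i = j then 1 else 0 := fun i j => by
    rw [← inner_eq_dotProduct]
    exact orthonormal_iff_ite.1 u.orthonormal i j
  refine ⟨Matrix.of fun a i => u i a, ?_, ?_⟩
  · ext i j
    rw [Matrix.one_apply, ← ho i j]
    rfl
  · have hAu : A * Aᵀ * (Matrix.of fun a i => u i a)
        = (Matrix.of fun a i => u i a) * diagonal (fun i : Fin m => sigma A (i + 1) ^ 2) := by
      ext a i
      have h := congrFun (congrArg WithLp.ofLp (hu i)) a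
      simp only [Matrix.toLpLin_apply, mulVec_mulVec, WithLp.ofLp_smul, Pi.smul_apply,
        smul_eq_mul] at h
      rw [mul_diagonal, Matrix.of_apply, mul_comm]
      exact h
    have hU : (Matrix.of fun a i => u i a)ᵀ * (Matrix.of fun a i => u i a) = 1 := by
      ext i j
      rw [Matrix.one_apply, ← ho i j]
      rfl
    rw [transpose_mul, transpose_transpose, Matrix.mul_assoc, ← Matrix.mul_assoc A, hAu,
      ← Matrix.mul_assoc, hU, Matrix.one_mul]

theorem ridgeGram_eq_conj {U : Matrix (Fin m) (Fin m) ℝ} (hU : Uᵀ * U = 1) {τ : Fin m → ℝ}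
    (hτ : (Uᵀ * A) * (Uᵀ * A)ᵀ = diagonal τ) :
    ridgeGram A lam k = U * diagonal (fun i => τ i + lam * k) * Uᵀ := by
  have hU' : U * Uᵀ = 1 := mul_eq_one_comm.1 hU
  have e : diagonal (fun i => τ i + lam * k)
      = diagonal τ + (lam * k) • (1 : Matrix (Fin m) (Fin m) ℝ) := by
    rw [← diagonal_add, smul_one_eq_diagonal]
  rw [e, ← hτ, Matrix.mul_add, Matrix.add_mul, transpose_mul, transpose_transpose]
  simp only [← Matrix.mul_assoc, hU', Matrix.one_mul]
  rw [Matrix.mul_assoc (A * Aᵀ), hU', Matrix.mul_one, Matrix.mul_smul, Matrix.smul_mul, Matrix.mul_one, hU']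
  rfl

end DPP

/-! ### The spectrum of the mean projector. -/

section Spectrum

open Matrix

variable {m n : ℕ} (A : Matrix (Fin m) (Fin n) ℝ) {lam : ℝ} {k : ℕ}

theorem rank_eq_finrank_range : A.rank = Module.finrank ℝ (LinearMap.range (toEuclideanLin A)) := by
  rw [Matrix.toEuclideanLin_eq_toLin_orthonormal]
  exact rank_eq_finrank_range_toLin A _ _

theorem sigma_rank_pos (hA : A ≠ 0) : 0 < sigma A A.rank := by
  have h : 0 < A.rank := by
    rw [rank_eq_finrank_range, Module.finrank_pos_iff_of_free,
      Submodule.nontrivial_iff_ne_bot, Ne, LinearMap.range_eq_bot]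
    simpa using hA
  rw [sigma, LinearMap.singularValues_pos_iff_lt_finrank_range, ← rank_eq_finrank_range]
  omega

theorem sigma_eq_zero {i : ℕ} (hi : A.rank ≤ i) : sigma A (i + 1) = 0 := by
  rw [sigma, LinearMap.singularValues_eq_zero_iff_le_finrank_range, ← rank_eq_finrank_range]
  simpa using hi

theorem sigma_rank_le {i : ℕ} (hi : sigma A (i + 1) ≠ 0) : sigma A A.rank ≤ sigma A (i + 1) := by
  have h : i < A.rank := by
    by_contra! h
    exact hi (sigma_eq_zero A h)
  exact (toEuclideanLin A).singularValues_antitone (by simp; omega)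

theorem sum_sigma_sq_le (l : ℕ) :
    ∑ i ∈ (Finset.univ.filter (fun i : Fin m => (i : ℕ) < l))ᶜ, sigma A (i + 1) ^ 2
      ≤ ∑ j ∈ Finset.Ioc l A.rank, sigma A j ^ 2 := by
  rw [← Finset.sum_filter_of_ne (p := fun i : Fin m => (i : ℕ) < A.rank)
    (fun i _ hi => by
      by_contra! h
      exact hi (by rw [sigma_eq_zero A h]; simp))]
  refine (Finset.sum_image (f := fun j => sigma A j ^ 2) (g := fun i : Fin m => (i : ℕ) + 1)
    (fun i _ j _ h => Fin.ext (by simpa using h))).symm.le.trans ?_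
  refine Finset.sum_le_sum_of_subset_of_nonneg (fun j hj => ?_) fun _ _ _ => sq_nonneg _
  obtain ⟨i, hi, rfl⟩ := Finset.mem_image.1 hj
  simp only [Finset.mem_filter, Finset.mem_compl, Finset.mem_univ, true_and, not_lt] at hi
  rw [Finset.mem_Ioc]
  omega

/-- The exchange bound is used with `T` the indices of the `l` largest singular values.
Regularization contributes `k - l` copies of `λk` from `d i` and `m - l` from the complement of `T`,
hence `m + k - 2l`. -/
theorem minorWeight_lower (hA : A ≠ 0) (hc : 0 < lam * k) {l : ℕ} (hl : l < k) (hkm : k ≤ m)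
    (i : Fin m) (hi : sigma A (i + 1) ≠ 0) :
    ((k : ℝ) - l) / (((k : ℝ) - l) + kappaSq A l
          + ((m : ℝ) + k - 2 * l) * (lam * k / sigma A A.rank ^ 2))
        * minorSum (diagonal (fun i : Fin m => sigma A (i + 1) ^ 2 + lam * k)) k
      ≤ sigma A (i + 1) ^ 2 *
        minorWeight (fun i : Fin m => sigma A (i + 1) ^ 2 + lam * k) k i := by
  have hd : ∀ i : Fin m, 0 < sigma A (i + 1) ^ 2 + lam * k := fun i => by positivity
  have hr := sigma_rank_pos A hA
  have hri := sigma_rank_le A hi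
  have hsq : sigma A A.rank ^ 2 ≤ sigma A (i + 1) ^ 2 := pow_le_pow_left₀ hr.le hri 2
  have hr2 : 0 < sigma A A.rank ^ 2 := by positivity
  have hi2 : 0 < sigma A (i + 1) ^ 2 := hr2.trans_le hsq
  have hlk : (l : ℝ) < k := by exact_mod_cast hl
  have hkm' : (k : ℝ) ≤ m := by exact_mod_cast hkm
  set T : Finset (Fin m) := Finset.univ.filter (fun i : Fin m => (i : ℕ) < l) with hT
  have hcard : T.card = l := by
    rw [hT, Fin.card_filter_val_lt]
    omega
  have h1 := minorSum_diagonal_le hd k T i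
  rw [hcard, Finset.sum_add_distrib, Finset.sum_const, Finset.card_compl, hcard, Fintype.card_fin,
    nsmul_eq_mul, Nat.cast_sub (by omega)] at h1
  have h2 := sum_sigma_sq_le A l
  have hK : ∑ j ∈ Finset.Ioc l A.rank, sigma A j ^ 2 = kappaSq A l * sigma A A.rank ^ 2 := by
    rw [kappaSq, Finset.sum_mul]
    refine Finset.sum_congr rfl fun j _ => ?_
    field_simp
  rw [hK] at h2
  have hk0 : 0 ≤ kappaSq A l := Finset.sum_nonneg fun j _ => by positivity
  have hw : 0 < minorWeight (fun i : Fin m => sigma A (i + 1) ^ 2 + lam * k) k i :=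
    minorWeight_pos hd (by omega) (by simpa using hkm) i
  set w := minorWeight (fun i : Fin m => sigma A (i + 1) ^ 2 + lam * k) k i
  set Z := minorSum (diagonal (fun i : Fin m => sigma A (i + 1) ^ 2 + lam * k)) k
  have hq : 0 ≤ ((m : ℝ) + k - 2 * l) * (lam * k / sigma A A.rank ^ 2) :=
    mul_nonneg (by linarith) (by positivity)
  have hD : 0 < ((k : ℝ) - l) + kappaSq A l
      + ((m : ℝ) + k - 2 * l) * (lam * k / sigma A A.rank ^ 2) := by linarith
  rw [div_mul_eq_mul_div, div_le_iff₀ hD]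
  refine h1.trans ?_
  rw [mul_comm (sigma A (i + 1) ^ 2) w, mul_assoc]
  refine mul_le_mul_of_nonneg_left ?_ hw.le
  have h3 : ((m : ℝ) + k - 2 * l) * (lam * k)
      = sigma A A.rank ^ 2 * (((m : ℝ) + k - 2 * l) * (lam * k / sigma A A.rank ^ 2)) := by
    field_simp
  have h4 := mul_le_mul_of_nonneg_right hsq hk0
  have h5 := mul_le_mul_of_nonneg_right hsq hq
  linarith

theorem minorForm_ridgeGram {U : Matrix (Fin m) (Fin m) ℝ} (hU : Uᵀ * U = 1)
    (hτ : (Uᵀ * A) * (Uᵀ * A)ᵀ = diagonal (fun i : Fin m => sigma A (i + 1) ^ 2))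
    (hc : 0 < lam * k) (u v : Fin m → ℝ) :
    minorForm (ridgeGram A lam k) k u v = ∑ i, (Uᵀ *ᵥ u) i * (Uᵀ *ᵥ v) i *
      minorWeight (fun i : Fin m => sigma A (i + 1) ^ 2 + lam * k) k i := by
  rw [ridgeGram_eq_conj A hU hτ]
  exact minorForm_conj hU (fun i => by positivity) k u v

theorem row_eq_zero {U : Matrix (Fin m) (Fin m) ℝ} {τ : Fin m → ℝ}
    (hτ : (Uᵀ * A) * (Uᵀ * A)ᵀ = diagonal τ) {i : Fin m} (hi : τ i = 0) (x : Fin n → ℝ) :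
    (Uᵀ *ᵥ (A *ᵥ x)) i = 0 := by
  have h : (fun j => (Uᵀ * A) i j) ⬝ᵥ (fun j => (Uᵀ * A) i j) = 0 := by
    have := congrFun (congrFun hτ i) i
    rwa [diagonal_apply_eq, hi] at this
  have h0 : (Uᵀ * A) i = 0 := dotProduct_self_eq_zero.1 h
  rw [mulVec_mulVec]
  simp [mulVec, h0]

/-- With `c = Uᵀ y`, the two sides are `∑ σ_i² c_i²` and `∑ σ_i⁴ c_i² w_i / Z` up to the constant,
so the comparison is termwise; indices with `σ_i = 0` contribute nothing. -/
theorem meanProj_lower (hA : A ≠ 0) (hc : 0 < lam * k) {l : ℕ} (hl : l < k) (hkm : k ≤ m)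
    (y : Fin m → ℝ) :
    ((k : ℝ) - l) / (((k : ℝ) - l) + kappaSq A l
          + ((m : ℝ) + k - 2 * l) * (lam * k / sigma A A.rank ^ 2)) *
        ((Aᵀ *ᵥ y) ⬝ᵥ (Aᵀ *ᵥ y))
      ≤ (Aᵀ *ᵥ y) ⬝ᵥ meanProj A lam k *ᵥ (Aᵀ *ᵥ y) := by
  obtain ⟨U, hU, hτ⟩ := exists_leftSingularMatrix A
  have hU' : U * Uᵀ = 1 := mul_eq_one_comm.1 hU
  have hZ := minorSum_ridgeGram_pos A hc hkm
  have hZ' : minorSum (ridgeGram A lam k) k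
      = minorSum (diagonal (fun i : Fin m => sigma A (i + 1) ^ 2 + lam * k)) k := by
    rw [ridgeGram_eq_conj A hU hτ, minorSum_conj hU]
  rw [dotProduct_meanProj, minorForm_ridgeGram A hU hτ hc, le_div_iff₀ hZ, hZ']
  have hz : ∀ i, (Uᵀ *ᵥ (A *ᵥ (Aᵀ *ᵥ y))) i = sigma A (i + 1) ^ 2 * (Uᵀ *ᵥ y) i := fun i => by
    have h1 : Uᵀ *ᵥ (A *ᵥ (Aᵀ *ᵥ y)) = (Uᵀ * A * (Uᵀ * A)ᵀ) *ᵥ (Uᵀ *ᵥ y) := by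
      simp only [mulVec_mulVec, transpose_mul, transpose_transpose, Matrix.mul_assoc, hU',
        Matrix.mul_one]
    rw [h1, hτ, mulVec_diagonal]
  have hn : (Aᵀ *ᵥ y) ⬝ᵥ (Aᵀ *ᵥ y) = ∑ i : Fin m, sigma A (i + 1) ^ 2 * (Uᵀ *ᵥ y) i ^ 2 := by
    rw [dotProduct_mulVec_transpose, ← Matrix.one_mulVec (A *ᵥ (Aᵀ *ᵥ y)), ← hU', ← mulVec_mulVec,
      dotProduct_comm, ← transpose_transpose U, dotProduct_mulVec_transpose, transpose_transpose]
    refine Finset.sum_congr rfl fun i _ => ?_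
    rw [hz]
    ring
  rw [hn, Finset.mul_sum, Finset.sum_mul]
  refine Finset.sum_le_sum fun i _ => ?_
  rw [hz]
  by_cases hi : sigma A (i + 1) = 0
  · simp [hi]
  · have h := minorWeight_lower A hA hc hl hkm i hi
    have h0 : 0 ≤ sigma A (i + 1) ^ 2 * (Uᵀ *ᵥ y) i ^ 2 := by positivity
    have := mul_le_mul_of_nonneg_left h h0
    linarith

/-- All weights are strictly positive, so averaging creates no kernel beyond that of `A`; the range
of `Aᵀ` is thus orthogonal to the kernel of `P̄`. -/
theorem mulVec_eq_zero_of_meanProj (hc : 0 < lam * k) (hk : 1 ≤ k) (hkm : k ≤ m) {x : Fin n → ℝ}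
    (hx : meanProj A lam k *ᵥ x = 0) : A *ᵥ x = 0 := by
  obtain ⟨U, hU, hτ⟩ := exists_leftSingularMatrix A
  have hU' : U * Uᵀ = 1 := mul_eq_one_comm.1 hU
  have hw : ∀ i, 0 < minorWeight (fun i : Fin m => sigma A (i + 1) ^ 2 + lam * k) k i :=
    minorWeight_pos (fun i => by positivity) hk (by simpa using hkm)
  have h1 := dotProduct_meanProj A (lam := lam) (k := k) x x
  rw [hx, dotProduct_zero, eq_comm, div_eq_zero_iff,
    or_iff_left (minorSum_ridgeGram_pos A hc hkm).ne', minorForm_ridgeGram A hU hτ hc] at h1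
  have h2 : Uᵀ *ᵥ (A *ᵥ x) = 0 := by
    funext i
    have h3 := (Finset.sum_eq_zero_iff_of_nonneg
      fun i _ => mul_nonneg (mul_self_nonneg _) (hw i).le).1 h1 i (Finset.mem_univ i)
    exact mul_self_eq_zero.1 ((mul_eq_zero.1 h3).resolve_right (hw i).ne')
  rw [← Matrix.one_mulVec (A *ᵥ x), ← hU', ← mulVec_mulVec, h2, mulVec_zero]

/-- Tested against `x`, the sum is diagonal in the left singular basis: where `σ_i = 0` the
coordinate of `A x` vanishes, elsewhere that of `z` does. -/
theorem sum_dppProb_gain (hc : 0 < lam * k) {z : Fin m → ℝ} (hz : Aᵀ *ᵥ z = 0) :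
    ∑ S : Finset (Fin m), dppProb A lam k S • (gain A lam k S *ᵥ fun i : S => z i) = 0 := by
  obtain ⟨U, hU, hτ⟩ := exists_leftSingularMatrix A
  have hU' : U * Uᵀ = 1 := mul_eq_one_comm.1 hU
  refine dotProduct_eq_zero _ fun x => ?_
  rw [dotProduct_comm, dotProduct_sum]
  have e : ∀ S : Finset (Fin m), x ⬝ᵥ dppProb A lam k S • (gain A lam k S *ᵥ fun i : S => z i)
      = dppProb A lam k S * ((fun i : S => (A *ᵥ x) i) ⬝ᵥ
        (regGram A lam k S)⁻¹ *ᵥ (fun i : S => z i)) := fun S => by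
    rw [dotProduct_smul, dotProduct_gain, smul_eq_mul]
  simp only [e]
  rw [sum_dppProb_mul_form, minorForm_ridgeGram A hU hτ hc]
  refine div_eq_zero_iff.2 (Or.inl (Finset.sum_eq_zero fun i _ => ?_))
  by_cases hi : sigma A (i + 1) = 0
  · rw [row_eq_zero A hτ (by simp [hi])]
    simp
  · have h1 : (Uᵀ * A * (Uᵀ * A)ᵀ) *ᵥ (Uᵀ *ᵥ z) = 0 := by
      rw [transpose_mul, transpose_transpose, mulVec_mulVec]
      have : Uᵀ * A * (Aᵀ * U) * Uᵀ = Uᵀ * A * Aᵀ := by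
        simp only [Matrix.mul_assoc, hU', Matrix.mul_one]
      rw [this, ← mulVec_mulVec, hz, mulVec_zero]
    have h2 := congrFun h1 i
    rw [hτ, mulVec_diagonal] at h2
    rw [(mul_eq_zero.1 h2).resolve_left (by simpa using hi)]
    simp

end Spectrum

/-! ### Normal equations and the range of the pseudoinverse. -/

section Pinv

open Matrix

variable {m n : ℕ} (A : Matrix (Fin m) (Fin n) ℝ) (b : EuclideanSpace ℝ (Fin m))

theorem lsSol_mem_range : lsSol A b ∈ LinearMap.range (toEuclideanLin Aᵀ) := by
  have h := pinv_isMoorePenrose A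
  have e : pinv A = Aᵀ * ((pinv A)ᵀ * pinv A) := by
    rw [← Matrix.mul_assoc, ← transpose_mul, h.symm_right, h.self_mul_mul]
  refine ⟨toEuclideanLin ((pinv A)ᵀ * pinv A) b, ?_⟩
  rw [lsSol]
  conv_rhs => rw [e]
  simp only [Matrix.toLpLin_apply, mulVec_mulVec]

theorem transpose_mulVec_residual : Aᵀ *ᵥ (residual A b).ofLp = 0 := by
  have h := pinv_isMoorePenrose A
  have e : Aᵀ * (A * pinv A) = Aᵀ := by
    conv_rhs => rw [← h.mul_mul_self, transpose_mul, h.symm_left]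
  simp only [residual, lsSol, Matrix.toLpLin_apply, WithLp.ofLp_sub, mulVec_sub, mulVec_mulVec, e,
    sub_self]

end Pinv

/-! ### ReBlocK as an instance of the affine recursion. -/

section Assembly

open Matrix

variable {m n : ℕ} (A : Matrix (Fin m) (Fin n) ℝ) (lam : ℝ) (k : ℕ)

/-- The regularized projector `A_Sᵀ (A_S A_Sᵀ + λ k I)⁻¹ A_S` as an operator. -/
def regProj (S : Finset (Fin m)) : EuclideanSpace ℝ (Fin n) →L[ℝ] EuclideanSpace ℝ (Fin n) :=
  LinearMap.toContinuousLinearMap (toEuclideanLin (gain A lam k S * rowBlock A S))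

/-- The noise `A_Sᵀ (A_S A_Sᵀ + λ k I)⁻¹ r_S`. -/
def regNoise (b : EuclideanSpace ℝ (Fin m)) (S : Finset (Fin m)) : EuclideanSpace ℝ (Fin n) :=
  toEuclideanLin (gain A lam k S) (vecBlock (residual A b) S)

theorem ofLp_regProj (S : Finset (Fin m)) (x : EuclideanSpace ℝ (Fin n)) :
    (regProj A lam k S x).ofLp = gain A lam k S *ᵥ (rowBlock A S *ᵥ x.ofLp) := by
  rw [mulVec_mulVec]
  rfl

theorem avgOp_regProj (x : EuclideanSpace ℝ (Fin n)) :
    avgOp (dppProb A lam k) (regProj A lam k) x = toEuclideanLin (meanProj A lam k) x := by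
  rw [avgOp_apply, meanProj, map_sum, LinearMap.sum_apply]
  refine Finset.sum_congr rfl fun S _ => ?_
  rw [map_smul]
  rfl

theorem toEuclideanLin_gain_mem (S : Finset (Fin m)) (z : EuclideanSpace ℝ S) :
    toEuclideanLin (gain A lam k S) z ∈ LinearMap.range (toEuclideanLin Aᵀ) := by
  -- `J` is the coordinate inclusion of `S`, so `A_Sᵀ` factors through `Aᵀ`.
  let J : Matrix (Fin m) S ℝ := Matrix.of fun i j => if i = (j : Fin m) then 1 else 0
  have hJ : (rowBlock A S)ᵀ = Aᵀ * J := by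
    ext i j
    simp [J, rowBlock, Matrix.mul_apply]
  refine ⟨toEuclideanLin (J * (regGram A lam k S)⁻¹) z, ?_⟩
  rw [gain, hJ]
  simp only [Matrix.toLpLin_apply, mulVec_mulVec, Matrix.mul_assoc]

variable {lam k}

theorem isAveraging_regProj (hc : 0 < lam * k) (hkm : k ≤ m) :
    IsAveraging (dppProb A lam k) (regProj A lam k) where
  nonneg := dppProb_nonneg A hc
  sum_eq_one := sum_dppProb A hc hkm
  symm S x y := by
    have hs : (regGram A lam k S)⁻¹ᵀ = (regGram A lam k S)⁻¹ := transpose_inv_ridge _ _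
    rw [inner_eq_dotProduct, inner_eq_dotProduct, ofLp_regProj, ofLp_regProj, dotProduct_comm,
      dotProduct_gain, dotProduct_gain, rowBlock_mulVec, rowBlock_mulVec, dotProduct_mulVec,
      ← mulVec_transpose, hs, dotProduct_comm]
  sq_le S x := by
    rw [norm_sq_eq_dotProduct, inner_eq_dotProduct, ofLp_regProj, gain, ← mulVec_mulVec]
    exact ridge_contraction (rowBlock A S) hc x.ofLp

theorem regProj_mem (S : Finset (Fin m)) (x : EuclideanSpace ℝ (Fin n)) :
    regProj A lam k S x ∈ LinearMap.range (toEuclideanLin Aᵀ) := by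
  have h := toEuclideanLin_gain_mem A lam k S (WithLp.toLp 2 (rowBlock A S *ᵥ x.ofLp))
  have e : regProj A lam k S x
      = toEuclideanLin (gain A lam k S) (WithLp.toLp 2 (rowBlock A S *ᵥ x.ofLp)) :=
    WithLp.ofLp_injective _ (ofLp_regProj A lam k S x)
  rwa [e]

theorem isSymmetric_meanProj (hc : 0 < lam * k) (hkm : k ≤ m) :
    (toEuclideanLin (meanProj A lam k)).IsSymmetric := fun x y => by
  rw [← avgOp_regProj, ← avgOp_regProj]
  exact (isAveraging_regProj A hc hkm).avgOp_symm x y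

theorem meanProj_nonneg (hc : 0 < lam * k) (hkm : k ≤ m) (x : EuclideanSpace ℝ (Fin n)) :
    0 ≤ inner ℝ x (toEuclideanLin (meanProj A lam k) x) := by
  rw [← avgOp_regProj]
  exact (isAveraging_regProj A hc hkm).inner_avgOp_nonneg x

theorem mulVec_eq_zero_of_mem_ker (hc : 0 < lam * k) (hk : 1 ≤ k) (hkm : k ≤ m)
    {x : EuclideanSpace ℝ (Fin n)} (hx : toEuclideanLin (meanProj A lam k) x = 0) :
    A *ᵥ x.ofLp = 0 :=
  mulVec_eq_zero_of_meanProj A hc hk hkm (congrArg WithLp.ofLp hx)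

theorem meanProj_ne_zero (hA : A ≠ 0) (hc : 0 < lam * k) (hk : 1 ≤ k) (hkm : k ≤ m) :
    toEuclideanLin (meanProj A lam k) ≠ 0 := fun h => hA <| by
  ext i j
  have h1 := mulVec_eq_zero_of_mem_ker A hc hk hkm
    (x := WithLp.toLp 2 (Pi.single j 1)) (by rw [h]; rfl)
  have h2 := congrFun h1 i
  simpa using h2

theorem alpha_mem (hA : A ≠ 0) (hc : 0 < lam * k) (hk : 1 ≤ k) (hkm : k ≤ m) :
    alpha A lam k ∈ posSingularValues (toEuclideanLin (meanProj A lam k)) :=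
  sInf_posSingularValues_mem (meanProj_ne_zero A hA hc hk hkm)

theorem alpha_pos (hA : A ≠ 0) (hc : 0 < lam * k) (hk : 1 ≤ k) (hkm : k ≤ m) :
    0 < alpha A lam k := by
  obtain ⟨h0, j, -, hj⟩ := alpha_mem A hA hc hk hkm
  refine lt_of_le_of_ne ?_ (Ne.symm h0)
  rw [hj]
  exact LinearMap.singularValues_nonneg _ _

theorem exists_eigenvector_alpha (hA : A ≠ 0) (hc : 0 < lam * k) (hk : 1 ≤ k) (hkm : k ≤ m) :
    ∃ v ≠ 0, toEuclideanLin (meanProj A lam k) v = alpha A lam k • v := by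
  obtain ⟨h0, j, -, hj⟩ := alpha_mem A hA hc hk hkm
  rw [hj] at h0 ⊢
  exact exists_eigenvector_of_singularValue (isSymmetric_meanProj A hc hkm)
    (meanProj_nonneg A hc hkm) h0

theorem isScheme_regProj (hA : A ≠ 0) (hc : 0 < lam * k) (hk : 1 ≤ k) (hkm : k ≤ m) :
    IsScheme (dppProb A lam k) (regProj A lam k) (LinearMap.range (toEuclideanLin Aᵀ))
      (alpha A lam k) where
  toIsAveraging := isAveraging_regProj A hc hkm
  mem := regProj_mem A
  lower w hw := by
    rw [avgOp_regProj]
    refine sInf_posSingularValues_mul_le (isSymmetric_meanProj A hc hkm)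
      (meanProj_nonneg A hc hkm) ((Submodule.mem_orthogonal _ _).2 fun v hv => ?_)
    obtain ⟨y, rfl⟩ := hw
    have h0 := mulVec_eq_zero_of_mem_ker A hc hk hkm (LinearMap.mem_ker.1 hv)
    rw [inner_eq_dotProduct, Matrix.toLpLin_apply, dotProduct_mulVec_transpose, h0,
      zero_dotProduct]
  pos := alpha_pos A hA hc hk hkm
  le_one := by
    obtain ⟨v, hv, hTv⟩ := exists_eigenvector_alpha A hA hc hk hkm
    have h := (isAveraging_regProj A hc hkm).inner_avgOp_le v
    rw [avgOp_regProj, hTv, real_inner_smul_right, real_inner_self_eq_norm_sq] at h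
    have : 0 < ‖v‖ ^ 2 := by positivity
    nlinarith

theorem le_alpha (hA : A ≠ 0) (hc : 0 < lam * k) (hk : 1 ≤ k) (hkm : k ≤ m) {l : ℕ} (hl : l < k) :
    ((k : ℝ) - l) / (((k : ℝ) - l) + kappaSq A l
          + ((m : ℝ) + k - 2 * l) * (lam * k / sigma A A.rank ^ 2)) ≤ alpha A lam k := by
  obtain ⟨v, hv, hTv⟩ := exists_eigenvector_alpha A hA hc hk hkm
  have ha := alpha_pos A hA hc hk hkm
  -- As `α ≠ 0`, `v = α⁻¹ P̄ v` lies in the range of `Aᵀ`, where the quadratic form bound is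
  -- available.
  have hvW : v ∈ LinearMap.range (toEuclideanLin Aᵀ) := by
    have h1 := (isScheme_regProj A hA hc hk hkm).avgOp_mem v
    rw [avgOp_regProj, hTv] at h1
    exact (Submodule.smul_mem_iff _ ha.ne').1 h1
  obtain ⟨y, rfl⟩ := hvW
  have h1 := meanProj_lower A hA hc hl hkm y.ofLp
  set w := toEuclideanLin Aᵀ y with hw
  have e1 : (Aᵀ *ᵥ y.ofLp) ⬝ᵥ (Aᵀ *ᵥ y.ofLp) = ‖w‖ ^ 2 := (norm_sq_eq_dotProduct w).symm
  have e2 : (Aᵀ *ᵥ y.ofLp) ⬝ᵥ meanProj A lam k *ᵥ (Aᵀ *ᵥ y.ofLp)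
      = inner ℝ w (toEuclideanLin (meanProj A lam k) w) :=
    (inner_eq_dotProduct w (toEuclideanLin (meanProj A lam k) w)).symm
  rw [e1, e2, hTv, real_inner_smul_right, real_inner_self_eq_norm_sq] at h1
  exact le_of_mul_le_mul_right h1 (by positivity)

variable (b : EuclideanSpace ℝ (Fin m))

theorem sum_dppProb_regNoise (hc : 0 < lam * k) :
    ∑ S, dppProb A lam k S • regNoise A lam k b S = 0 := by
  refine WithLp.ofLp_injective _ ?_
  rw [WithLp.ofLp_sum]
  exact sum_dppProb_gain A hc (transpose_mulVec_residual A b)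

theorem step_sub_lsSol (S : Finset (Fin m)) (x : EuclideanSpace ℝ (Fin n)) :
    step A b lam k S x - lsSol A b
      = (x - lsSol A b) - regProj A lam k S (x - lsSol A b) + regNoise A lam k b S := by
  have h1 : vecBlock (residual A b) S
      = vecBlock b S - toEuclideanLin (rowBlock A S) (lsSol A b) := rfl
  have h2 : ∀ y, regProj A lam k S y
      = toEuclideanLin (gain A lam k S) (toEuclideanLin (rowBlock A S) y) := fun y =>
    WithLp.ofLp_injective _ (ofLp_regProj A lam k S y)
  rw [step, regNoise, h1, h2]
  simp only [map_sub]
  abel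

theorem iter_sub_lsSol (x₀ : EuclideanSpace ℝ (Fin n)) (S : ℕ → Finset (Fin m)) (t : ℕ) :
    iter A b lam k x₀ S t - lsSol A b
      = affProc (regProj A lam k) (regNoise A lam k b) (x₀ - lsSol A b) S t := by
  induction t with
  | zero => rfl
  | succ t ih => rw [iter, step_sub_lsSol, ih, affProc]

theorem varTerm_le (hlam : 0 < lam) (hk : 1 ≤ k) (hkm : k ≤ m) :
    varTerm A b lam k ≤ 1 / (4 * lam) * (⨆ i : Fin m, (residual A b i) ^ 2) := by
  have hk0 : (0 : ℝ) < k := by exact_mod_cast hk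
  have hc : 0 < lam * k := mul_pos hlam hk0
  set M := ⨆ i : Fin m, (residual A b i) ^ 2 with hM
  have hle : ∀ i, (residual A b i) ^ 2 ≤ M := fun i =>
    le_ciSup (f := fun i => (residual A b i) ^ 2) (Set.finite_range _).bddAbove i
  have hterm : ∀ S, dppProb A lam k S *
      ‖toEuclideanLin (gain A lam k S) (vecBlock (residual A b) S)‖ ^ 2
      ≤ dppProb A lam k S * (1 / (4 * lam) * M) := fun S => by
    by_cases hS : S.card = k
    · refine mul_le_mul_of_nonneg_left ?_ (dppProb_nonneg A hc S)
      rw [norm_sq_eq_dotProduct, Matrix.toLpLin_apply, gain, ← mulVec_mulVec]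
      refine (ridge_gain_le (rowBlock A S) hc _).trans ?_
      have h1 : (vecBlock (residual A b) S).ofLp ⬝ᵥ (vecBlock (residual A b) S).ofLp ≤ k * M := by
        refine (Finset.sum_le_card_nsmul Finset.univ _ M fun i _ => ?_).trans (le_of_eq ?_)
        · rw [← pow_two]
          exact hle i
        · rw [Finset.card_univ, Fintype.card_coe, hS, nsmul_eq_mul]
      -- The `k` entries of the block cancel the `k` in the regularization `λk`.
      calc _ ≤ 1 / (4 * (lam * k)) * (k * M) := mul_le_mul_of_nonneg_left h1 (by positivity)
        _ = _ := by field_simp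
    · simp [dppProb, hS]
  refine (Finset.sum_le_sum fun S _ => hterm S).trans ?_
  rw [← Finset.sum_mul, sum_dppProb A hc hkm, one_mul]

theorem tailAvg_sub {x : ℕ → EuclideanSpace ℝ (Fin n)} (y : EuclideanSpace ℝ (Fin n)) {Tb N : ℕ}
    (hN : 0 < N) :
    tailAvg x Tb (Tb + N) - y = (N : ℝ)⁻¹ • ∑ t ∈ Finset.Icc (Tb + 1) (Tb + N), (x t - y) := by
  have h0 : (N : ℝ) ≠ 0 := by positivity
  rw [tailAvg, Finset.sum_sub_distrib, Finset.sum_const, Nat.card_Icc,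
    show Tb + N + 1 - (Tb + 1) = N by omega, smul_sub, ← Nat.cast_smul_eq_nsmul ℝ, smul_smul,
    inv_mul_cancel₀ h0, one_smul]
  push_cast
  rw [add_sub_cancel_left]

end Assembly

end ReBlocK

end

theorem theoremE1 {m n : ℕ} (A : Matrix (Fin m) (Fin n) ℝ) (hA : A ≠ 0)
    (b : EuclideanSpace ℝ (Fin m)) (lam : ℝ) (hlam : 0 < lam)
    (k : ℕ) (hk : 1 ≤ k) (hkm : k ≤ m)
    (x₀ : EuclideanSpace ℝ (Fin n))
    (hx₀ : x₀ ∈ LinearMap.range (Matrix.toEuclideanLin A.transpose))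
    {Ω : Type*} [MeasurableSpace Ω] (μ : Measure Ω) [IsProbabilityMeasure μ]
    (S : ℕ → Ω → Finset (Fin m)) (hmeas : ∀ t, Measurable (S t))
    (hindep : iIndepFun S μ)
    (hlaw : ∀ t s, μ.real {ω | S t ω = s} = ReBlocK.dppProb A lam k s)
    (x : ℕ → Ω → EuclideanSpace ℝ (Fin n))
    (hx : ∀ t ω, x t ω = ReBlocK.iter A b lam k x₀ (fun u => S u ω) t) :
    (0 < ReBlocK.alpha A lam k ∧ ReBlocK.alpha A lam k ≤ 1) ∧
    (∀ T : ℕ, Integrable (x T) μ ∧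
      ‖(∫ ω, x T ω ∂μ) - ReBlocK.lsSol A b‖
        ≤ (1 - ReBlocK.alpha A lam k) ^ T * ‖x₀ - ReBlocK.lsSol A b‖) ∧
    (∀ Tb T : ℕ, Tb < T →
      Integrable (fun ω => ‖ReBlocK.tailAvg (fun t => x t ω) Tb T - ReBlocK.lsSol A b‖ ^ 2) μ ∧
      ∫ ω, ‖ReBlocK.tailAvg (fun t => x t ω) Tb T - ReBlocK.lsSol A b‖ ^ 2 ∂μ
        ≤ 2 * (1 - ReBlocK.alpha A lam k) ^ (Tb + 1) * ‖x₀ - ReBlocK.lsSol A b‖ ^ 2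
          + 4 / (ReBlocK.alpha A lam k ^ 2 * ((T : ℝ) - (Tb : ℝ))) * ReBlocK.varTerm A b lam k) ∧
    ReBlocK.varTerm A b lam k
      ≤ 1 / (4 * lam) * (⨆ i : Fin m, (ReBlocK.residual A b i) ^ 2) ∧
    (∀ l : ℕ, l < k →
      ((k : ℝ) - l) / (((k : ℝ) - l) + ReBlocK.kappaSq A l
          + ((m : ℝ) + k - 2 * l) * (lam * k / ReBlocK.sigma A A.rank ^ 2))
        ≤ ReBlocK.alpha A lam k) := by
  have hc : 0 < lam * k := mul_pos hlam (by exact_mod_cast hk)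
  have hsch := ReBlocK.isScheme_regProj A hA hc hk hkm
  have hS : ReBlocK.IsSample μ S (ReBlocK.dppProb A lam k) := ⟨hmeas, hindep, hlaw⟩
  have hgW : ∀ s, ReBlocK.regNoise A lam k b s ∈
      LinearMap.range (Matrix.toEuclideanLin A.transpose) := fun s =>
    ReBlocK.toEuclideanLin_gain_mem A lam k s _
  have hg := ReBlocK.sum_dppProb_regNoise A b hc
  have hy := Submodule.sub_mem _ hx₀ (ReBlocK.lsSol_mem_range A b)
  have hxe : ∀ t ω, x t ω - ReBlocK.lsSol A b = ReBlocK.affProc (ReBlocK.regProj A lam k)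
      (ReBlocK.regNoise A lam k b) (x₀ - ReBlocK.lsSol A b) (fun u => S u ω) t := fun t ω => by
    rw [hx, ReBlocK.iter_sub_lsSol]
  refine ⟨⟨hsch.pos, hsch.le_one⟩, fun T => ?_, fun Tb T hT => ?_,
    ReBlocK.varTerm_le A b hlam hk hkm, fun l hl => ReBlocK.le_alpha A hA hc hk hkm hl⟩
  · have hxT : Integrable (x T) μ := by
      have h := ((ReBlocK.adaptedAt_affProc (ReBlocK.regProj A lam k)
        (ReBlocK.regNoise A lam k b) (x₀ - ReBlocK.lsSol A b) S T).comp
          (fun y => y + ReBlocK.lsSol A b)).integrable (μ := μ) hmeas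
      refine h.congr (Filter.Eventually.of_forall fun ω => ?_)
      simp only [← hxe, sub_add_cancel]
    refine ⟨hxT, ?_⟩
    have h := hS.norm_integral_affProc_le hsch hg hy T
    simp only [← hxe] at h
    rw [integral_sub hxT (integrable_const _)] at h
    simpa using h
  -- The averaging window has length `N + 1`, so its reciprocal is meaningful.
  · obtain ⟨N, rfl⟩ := Nat.exists_eq_add_of_lt hT
    rw [add_assoc]
    have hN : (0 : ℝ) < (N + 1 : ℕ) := by positivity
    have hsum : ∀ ω, ‖ReBlocK.tailAvg (fun t => x t ω) Tb (Tb + (N + 1)) - ReBlocK.lsSol A b‖ ^ 2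
        = ((N + 1 : ℕ) : ℝ)⁻¹ ^ 2 * ‖∑ t ∈ Finset.Icc (Tb + 1) (Tb + (N + 1)),
          ReBlocK.affProc (ReBlocK.regProj A lam k) (ReBlocK.regNoise A lam k b)
            (x₀ - ReBlocK.lsSol A b) (fun u => S u ω) t‖ ^ 2 := fun ω => by
      rw [ReBlocK.tailAvg_sub _ N.succ_pos, norm_smul, mul_pow, Real.norm_eq_abs, sq_abs]
      simp only [hxe, Nat.succ_eq_add_one]
    simp only [hsum]
    refine ⟨((ReBlocK.adaptedAt_sum_affProc (ReBlocK.regProj A lam k) (ReBlocK.regNoise A lam k b)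
      (x₀ - ReBlocK.lsSol A b) S Tb (Tb + (N + 1))).comp
        fun y => ((N + 1 : ℕ) : ℝ)⁻¹ ^ 2 * ‖y‖ ^ 2).integrable hmeas, ?_⟩
    rw [integral_const_mul]
    have h := hS.integral_norm_sq_sum_le hsch hgW hg hy Tb (N + 1)
    have hV : ∑ s, ReBlocK.dppProb A lam k s * ‖ReBlocK.regNoise A lam k b s‖ ^ 2
        = ReBlocK.varTerm A b lam k := rfl
    rw [hV] at h
    refine (mul_le_mul_of_nonneg_left h (by positivity)).trans (le_of_eq ?_)
    have ha := hsch.pos.ne'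
    rw [Nat.cast_add Tb, add_sub_cancel_left]
    field_simp
    ring
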